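/- Consider a finite simple undirected graph $G$ whose nodes are colored with two colors. A node is \emph{switchable} if strictly more of its neighbors have its own color than the opposite color; its \emph{balance} is the number of neighbors of the opposite color minus the number of neighbors of the same color. In each step of the minority process a set of switchable nodes is chosen, and all of them simultaneously switch to the opposite color. A coloring is \emph{stable} if no node is switchable, and the stabilization time is the number of steps until a stable coloring is reached. The models are as follows. (B) \emph{Sequential benevolent}, (C) \emph{independent benevolent}, (D) \emph{free benevolent}: in each step a player chooses, respectively, one switchable node, any nonempty independent set of switchable nodes, any nonempty set of switchable nodes; the stabilization time is the minimum over all sequences of choices. (E) \emph{Concurrent synchronous}: in each step all switchable nodes switch. (F) \emph{Sequential random}: in each step one switchable node, chosen uniformly at random among the switchable nodes, switches. (G) \emph{Concurrent random with probability} $p\in(0,1]$: in each step each switchable node switches with probability $p$, independently of the other nodes. **Theorem.** There are constants $a>0$ and $N$ such that for every $n\ge N$ there is a graph $G$ on $n$ nodes with an initial 2-coloring such that all of the following hold for this one pair of graph and initial coloring. 1. In each of the models B, C, D and E the stabilization time is finite and at least $a\,n^{3/2}$. In model F, and in model G for every $p\in(0,1]$, the stabilization time is almost surely at least $a\,n^{3/2}$,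 and its expectation is finite. 2. In every coloring that can be reached from the initial one by steps in which arbitrary sets of switchable nodes switch, the set of switchable nodes is an independent set. 3. $G$ contains a chain of $m\ge a\,n$ relays with distinct base nodes $B_1,\dots,B_m$: consecutive base nodes are adjacent and have opposite initial colors, each $B_i$ has initial balance $1$, and each $B_i$ is adjacent to an upper node, which is not one of the base nodes and has the same initial color as $B_i$. In every reachable coloring (as in 2) in which some $B_i$ is switchable, $B_i$ is the only switchable node of the graph; and in every sequence of steps as in 2 that leads from the initial coloring to a stable coloring, each $B_i$ switches at least $a\sqrt n$ times. -/

import Mathlib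

open MeasureTheory ProbabilityTheory
open scoped ENNReal

namespace MinorityProcess

/-! ### The minority process with two colors -/

/-- A coloring of the nodes with two colors (`true` and `false`, say white and black). -/
abbrev Coloring (V : Type*) := V → Bool

section Dynamics

variable {V : Type*}

/-- The number of neighbors of `v` that have color `x`. -/
noncomputable def colorCount (G : SimpleGraph V) (c : Coloring V) (v : V) (x : Bool) : ℕ :=
  {w | G.Adj v w ∧ c w = x}.ncard

/-- A node is switchable if some color is strictly less frequent in its neighborhood than the
current color of the node. -/
def switchable (G : SimpleGraph V) (c : Coloring V) : Set V :=
  {v | ∃ x : Bool, colorCount G c v x < colorCount G c v (c v)}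

/-- A state is stable if no node is switchable. -/
def IsStableState (G : SimpleGraph V) (c : Coloring V) : Prop :=
  switchable G c = ∅

/-- The balance of a node: the number of neighbors of the opposite color minus the number of
neighbors of the same color. -/
noncomputable def balance (G : SimpleGraph V) (c : Coloring V) (v : V) : ℤ :=
  (colorCount G c v (!c v) : ℤ) - (colorCount G c v (c v) : ℤ)

open Classical in
/-- The coloring obtained from `c` when all the nodes of `S` switch simultaneously. -/
noncomputable def switch (c : Coloring V) (S : Set V) : Coloring V :=
  fun v => if v ∈ S then !c v else c v

theorem mem_switchable_iff_balance_neg (G : SimpleGraph V) (c : Coloring V) (v : V) :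
    v ∈ switchable G c ↔ balance G c v < 0 := by
  unfold switchable balance
  rw [Set.mem_ofPred_eq, Bool.exists_bool]
  cases c v <;> simp

/-- A switchable node switches to the unique color which is least frequent in its neighborhood
(so no tie-breaking rule is needed). -/
theorem switch_isLeast_of_mem (G : SimpleGraph V) (c : Coloring V) (S : Set V) (v : V)
    (hv : v ∈ S) (hs : v ∈ switchable G c) (x : Bool) (hx : x ≠ switch c S v) :
    colorCount G c v (switch c S v) < colorCount G c v x := by
  rw [mem_switchable_iff_balance_neg] at hs
  unfold balance at hs
  simp only [switch, hv, if_true] at hx ⊢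
  cases h : c v <;> cases x <;> simp_all

/-! ### Models as rules for the admissible steps -/

/-- A model without randomness: `rule G c S` says that in state `c`, the nodes of `S` may be chosen
to switch simultaneously as the next step. -/
abbrev Rule (V : Type*) := SimpleGraph V → Coloring V → Set V → Prop

/-- Sequential model: one switchable node switches. -/
def sequential : Rule V := fun G c S => ∃ v ∈ switchable G c, S = {v}

/-- Independent model: a (nonempty) independent set of switchable nodes switches. -/
def independent : Rule V := fun G c S => S.Nonempty ∧ S ⊆ switchable G c ∧ G.IsIndepSet S

/-- Free model: any (nonempty) set of switchable nodes switches. -/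
def free : Rule V := fun G c S => S.Nonempty ∧ S ⊆ switchable G c

/-- Concurrent synchronous model: all switchable nodes switch (as long as there are any). -/
def synchronous : Rule V := fun G c S => S.Nonempty ∧ S = switchable G c

/-- `l` is a valid sequence of steps, starting from state `c`. -/
def IsRun (rule : Rule V) (G : SimpleGraph V) : Coloring V → List (Set V) → Prop
  | _, [] => True
  | c, S :: l => rule G c S ∧ IsRun rule G (switch c S) l

/-- The state after the sequence of steps `l` is executed from state `c`. -/
noncomputable def runEnd (c : Coloring V) (l : List (Set V)) : Coloring V :=
  l.foldl switch c

open Classical in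
/-- The number of times node `v` switches in the sequence of steps `l`. -/
noncomputable def switchCount (v : V) (l : List (Set V)) : ℕ :=
  l.countP fun S => decide (v ∈ S)

/-- The sequences of steps from `c` to a stable state. -/
def stabilizingRuns (rule : Rule V) (G : SimpleGraph V) (c : Coloring V) : Set (List (Set V)) :=
  {l | IsRun rule G c l ∧ IsStableState G (runEnd c l)}

/-- Stabilization time if a benevolent player chooses among the steps that the rule admits: the
minimal number of steps to a stable state, and `⊤` if no stable state can be reached. For
`synchronous`, where the sequence of steps is determined by the initial state, this is the number
of steps until the process stabilizes. -/
noncomputable def stabilizationTime (rule : Rule V) (G : SimpleGraph V) (c : Coloring V) : ℕ∞ :=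
  ⨅ l ∈ stabilizingRuns rule G c, (l.length : ℕ∞)

/-- The states that can occur when any set of switchable nodes may switch in each step. Every
state that occurs in any of the models (also in the random ones) is of this kind. -/
def reachable (G : SimpleGraph V) (c : Coloring V) : Set (Coloring V) :=
  {d | ∃ l, IsRun free G c l ∧ runEnd c l = d}

/-- A chain of `m` relays: distinct base nodes, alternating in initial color, such that consecutive
base nodes are adjacent; each base node is adjacent to a further node (its upper node) of its own
initial color, and has initial balance `1`. -/
structure RelayChain (G : SimpleGraph V) (c : Coloring V) (m : ℕ) where
  base : Fin m → V
  upper : Fin m → V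
  base_injective : Function.Injective base
  upper_ne_base : ∀ i j, upper i ≠ base j
  adj_upper : ∀ i, G.Adj (base i) (upper i)
  color_upper : ∀ i, c (upper i) = c (base i)
  adj_next : ∀ i j : Fin m, (i : ℕ) + 1 = j → G.Adj (base i) (base j)
  color_next : ∀ i j : Fin m, (i : ℕ) + 1 = j → c (base j) = !c (base i)
  balance_base : ∀ i, balance G c (base i) = 1

/-! ### Random models as Markov chains on colorings -/

theorem measurable_switch (c : Coloring V) : Measurable (switch c) := by
  classical
  refine measurable_pi_lambda _ fun v => ?_
  exact Measurable.ite (measurable_set_mem v).setOf measurable_const measurable_const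

end Dynamics

section Random

variable {V : Type*} [Fintype V]

open Classical in
/-- Law of the next state in the sequential random model: a node chosen uniformly at random among
the switchable nodes switches. A stable state does not change. -/
noncomputable def sequentialRandomStep (G : SimpleGraph V) (c : Coloring V) :
    Measure (Coloring V) :=
  if h : (switchable G c).toFinset.Nonempty then
    ((PMF.uniformOfFinset (switchable G c).toFinset h).map fun v => switch c {v}).toMeasure
  else Measure.dirac c

/-- Law of the next state in the concurrent random model: every switchable node switches with
probability `p`, independently of the others. -/
noncomputable def concurrentRandomStep (p : unitInterval) (G : SimpleGraph V) (c : Coloring V) :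
    Measure (Coloring V) :=
  (setBernoulli (switchable G c) p).map (switch c)

instance (G : SimpleGraph V) (c : Coloring V) : IsProbabilityMeasure (sequentialRandomStep G c) := by
  unfold sequentialRandomStep
  split_ifs <;> infer_instance

instance (p : unitInterval) (G : SimpleGraph V) (c : Coloring V) :
    IsProbabilityMeasure (concurrentRandomStep p G c) :=
  Measure.isProbabilityMeasure_map (measurable_switch c).aemeasurable

/-- The transition kernels of the time-homogeneous Markov chain whose next state has law `K c` if
the current state is `c`. -/
noncomputable def transition (K : Coloring V → Measure (Coloring V)) (t : ℕ) :
    Kernel ((i : Finset.Iic t) → (fun _ : ℕ => Coloring V) i) (Coloring V) :=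
  (Kernel.ofFunOfCountable K).comap (fun h => h ⟨t, Finset.mem_Iic.2 le_rfl⟩)
    (measurable_pi_apply _)

instance (K : Coloring V → Measure (Coloring V)) [h : ∀ c, IsProbabilityMeasure (K c)] (t : ℕ) :
    IsMarkovKernel (transition K t) := by
  have : IsMarkovKernel (Kernel.ofFunOfCountable K) := ⟨h⟩
  unfold transition
  infer_instance

/-- The law of the whole trajectory of the Markov chain with one-step laws `K`, started at `c`. -/
noncomputable def processLaw (K : Coloring V → Measure (Coloring V))
    [∀ c, IsProbabilityMeasure (K c)] (c : Coloring V) : Measure (ℕ → Coloring V) :=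
  Kernel.trajMeasure (X := fun _ => Coloring V) (Measure.dirac c) (transition K)

/-- The number of steps until the trajectory `ω` reaches a stable state (`⊤` if it never does). -/
noncomputable def pathStabilizationTime (G : SimpleGraph V) (ω : ℕ → Coloring V) : ℕ∞ :=
  ⨅ t ∈ {t : ℕ | IsStableState G (ω t)}, (t : ℕ∞)

end Random

end MinorityProcess

open MinorityProcess

/-! ### Forced trajectories and the models without randomness -/

namespace MinorityProcess

/-! The construction leaves no choice: until a stable state is reached, exactly one node is
switchable (`IsForced`). A nonempty set of switchable nodes is then that singleton, so models B to F
follow the same trajectory step by step, and model G follows it with random waiting times. All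
claims reduce to one forced trajectory of length of order n^(3/2).

The trajectory sends k + 1 waves, with k of order √n, along a path of m base nodes, with m of order
n. A base node effectively has three neighbors: predecessor, successor and an upper node. It
switches when the predecessor has just switched and the upper node has its own color, so the upper
nodes must be reset before the next wave. Each round has its own `a` charging and `b` upper nodes,
and each of these control nodes switches only once. An upper node serves about w = m / b base nodes;
with a, b, w and k of order √n, the k groups have order n nodes in total. A base node is joined to
the copies of its upper node in all rounds, but their colors alternate and k is odd, so all but one
cancel (`sum_spin_control`).

The end of a wave starts the first charging node of the next round. The round length a + b + m is
odd, so position 0 of round J + 1 continues the alternating colors of round J, and the sequence of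
positions behaves like a cycle (`biasedBalance_base`).

Control nodes are biased, through auxiliary nodes that never switch, to have balance -1 at their
turn. They must not be switchable earlier or later (`lt_totalSupport`, `totalSupport_le`). Control
neighbors help, as each changes only once. Base neighbors oscillate, but an upper node has at most w
+ 1 of them, and its charging neighbors outnumber these. -/

/-- A trajectory of length `T` along which exactly one node is switchable in each state, until a
stable state is reached. -/
structure IsForced {V : Type*} (G : SimpleGraph V) (c : ℕ → Coloring V) (v : ℕ → V) (T : ℕ) :
    Prop where
  switchable_eq : ∀ t < T, switchable G (c t) = {v t}
  step : ∀ t < T, c (t + 1) = switch (c t) {v t}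
  stable : IsStableState G (c T)

theorem free_of_rule {V : Type*} {rule : Rule V}
    (h : rule ∈ ({sequential, independent, free, synchronous} : Set (Rule V)))
    {G : SimpleGraph V} {c : Coloring V} {S : Set V} (hS : rule G c S) : free G c S := by
  rcases h with rfl | rfl | rfl | rfl
  · obtain ⟨v, hv, rfl⟩ := hS
    exact ⟨Set.singleton_nonempty v, by simpa using hv⟩
  · exact ⟨hS.1, hS.2.1⟩
  · exact hS
  · exact ⟨hS.1, hS.2.le⟩

theorem rule_singleton {V : Type*} {rule : Rule V}
    (h : rule ∈ ({sequential, independent, free, synchronous} : Set (Rule V)))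
    {G : SimpleGraph V} {c : Coloring V} {v : V} (hv : switchable G c = {v}) :
    rule G c {v} := by
  rcases h with rfl | rfl | rfl | rfl
  · exact ⟨v, by simp [hv], rfl⟩
  · exact ⟨Set.singleton_nonempty v, hv.ge, by simp [SimpleGraph.IsIndepSet]⟩
  · exact ⟨Set.singleton_nonempty v, hv.ge⟩
  · exact ⟨Set.singleton_nonempty v, hv.symm⟩

theorem IsRun.mono {V : Type*} {rule rule' : Rule V} {G : SimpleGraph V}
    (h : ∀ c S, rule G c S → rule' G c S) {c : Coloring V} {l : List (Set V)}
    (hl : IsRun rule G c l) : IsRun rule' G c l := by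
  induction l generalizing c with
  | nil => trivial
  | cons S l ih => exact ⟨h _ _ hl.1, ih hl.2⟩

namespace IsForced

variable {V : Type*} {G : SimpleGraph V} {c : ℕ → Coloring V} {v : ℕ → V} {T : ℕ}

theorem eq_of_isStableState (h : IsForced G c v T) {t : ℕ} (ht : t ≤ T)
    (hs : IsStableState G (c t)) : t = T := by
  by_contra hne
  have := h.switchable_eq t (by omega)
  rw [IsStableState] at hs
  simp [hs] at this

/-- A nonempty subset of a singleton is that singleton, so even the free model has one continuation
in each state. The lemma starts at an arbitrary time `t` to make the induction work. -/
theorem isRun_free (h : IsForced G c v T) {l : List (Set V)} {t : ℕ} (ht : t ≤ T)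
    (hl : IsRun free G (c t) l) :
    t + l.length ≤ T ∧ l = (List.range' t l.length).map (fun i => {v i}) ∧
      runEnd (c t) l = c (t + l.length) := by
  induction l generalizing t with
  | nil => simp [runEnd, ht]
  | cons S l ih =>
    obtain ⟨⟨hne, hsub⟩, hl⟩ := hl
    have htT : t < T := by
      refine lt_of_le_of_ne ht ?_
      rintro rfl
      have h0 := h.stable
      rw [IsStableState] at h0
      rw [h0] at hsub
      exact hne.ne_empty (Set.subset_empty_iff.1 hsub)
    rw [h.switchable_eq t htT] at hsub
    obtain rfl : S = {v t} := (Set.subset_singleton_iff_eq.1 hsub).resolve_left hne.ne_empty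
    rw [← h.step t htT] at hl
    obtain ⟨h1, h2, h3⟩ := ih (Nat.succ_le_of_lt htT) hl
    refine ⟨by simp; omega, ?_, ?_⟩
    · rw [List.length_cons, List.range'_succ, List.map_cons, ← h2]
    · rw [runEnd, List.foldl_cons, ← h.step t htT]
      rw [runEnd] at h3
      rw [h3, List.length_cons]
      congr 1
      omega

theorem isRun_range' (h : IsForced G c v T) {rule : Rule V}
    (hr : rule ∈ ({sequential, independent, free, synchronous} : Set (Rule V)))
    (r t : ℕ) (ht : t + r ≤ T) :
    IsRun rule G (c t) ((List.range' t r).map fun i => {v i}) := by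
  induction r generalizing t with
  | zero => trivial
  | succ r ih =>
    rw [List.range'_succ, List.map_cons]
    refine ⟨rule_singleton hr (h.switchable_eq t (by omega)), ?_⟩
    rw [← h.step t (by omega)]
    exact ih (t + 1) (by omega)

theorem eq_of_mem_stabilizingRuns (h : IsForced G c v T) {l : List (Set V)}
    (hl : l ∈ stabilizingRuns free G (c 0)) : l = (List.range T).map fun i => {v i} := by
  obtain ⟨h1, h2, h3⟩ := h.isRun_free (Nat.zero_le T) hl.1
  have h4 := hl.2
  rw [h3] at h4
  have h5 := h.eq_of_isStableState h1 h4
  rw [Nat.zero_add] at h5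
  rw [h5, ← List.range_eq_range'] at h2
  exact h2

theorem stabilizationTime_eq (h : IsForced G c v T) {rule : Rule V}
    (hr : rule ∈ ({sequential, independent, free, synchronous} : Set (Rule V))) :
    stabilizationTime rule G (c 0) = T := by
  apply le_antisymm
  · have hrun := h.isRun_range' hr T 0 (by omega)
    have hend := (h.isRun_free (Nat.zero_le T) (hrun.mono fun _ _ => free_of_rule hr)).2.2
    refine (iInf₂_le _ ⟨hrun, ?_⟩).trans (by simp)
    rw [hend]
    simpa using h.stable
  · refine le_iInf₂ fun l hl => ?_
    rw [h.eq_of_mem_stabilizingRuns ⟨hl.1.mono fun _ _ => free_of_rule hr, hl.2⟩]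
    simp

theorem exists_of_mem_reachable (h : IsForced G c v T) {d : Coloring V}
    (hd : d ∈ reachable G (c 0)) : ∃ t ≤ T, d = c t := by
  obtain ⟨l, hl, rfl⟩ := hd
  obtain ⟨h1, -, h3⟩ := h.isRun_free (Nat.zero_le T) hl
  exact ⟨_, h1, h3⟩

theorem switchable_eq_of_mem (h : IsForced G c v T) {d : Coloring V}
    (hd : d ∈ reachable G (c 0)) {x : V} (hx : x ∈ switchable G d) : switchable G d = {x} := by
  obtain ⟨t, ht, rfl⟩ := h.exists_of_mem_reachable hd
  rcases ht.lt_or_eq with ht | rfl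
  · rw [h.switchable_eq t ht] at hx ⊢
    rw [Set.mem_singleton_iff.1 hx]
  · rw [show switchable G (c t) = ∅ from h.stable] at hx
    exact hx.elim

theorem isIndepSet_switchable (h : IsForced G c v T) {d : Coloring V}
    (hd : d ∈ reachable G (c 0)) : G.IsIndepSet (switchable G d) := by
  intro x hx y hy hne
  rw [h.switchable_eq_of_mem hd hx] at hy
  exact (hne hy.symm).elim

theorem card_le_switchCount (h : IsForced G c v T) {l : List (Set V)}
    (hl : l ∈ stabilizingRuns free G (c 0)) (x : V) (s : Finset ℕ)
    (hs : ∀ t ∈ s, t < T ∧ v t = x) : s.card ≤ switchCount x l := by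
  classical
  rw [h.eq_of_mem_stabilizingRuns hl, switchCount, List.countP_map]
  have hcount : List.countP ((fun S : Set V => decide (x ∈ S)) ∘ fun i => {v i}) (List.range T) =
      Nat.count (fun t => v t = x) T := by
    rw [Nat.count]
    congr 1
    funext t
    simp [eq_comm]
  have hcard : s.card ≤ Nat.count (fun t => v t = x) T := by
    rw [Nat.count_eq_card_filter_range]
    refine Finset.card_le_card fun t ht => ?_
    simpa using hs t ht
  convert hcard using 1

end IsForced

/-! ### Random models: expectations along the chain and lazy forced chains -/

section MarkovChain

variable {V : Type*} [Fintype V] (K : Coloring V → Measure (Coloring V))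
  [∀ c, IsProbabilityMeasure (K c)] (c₀ : Coloring V)

theorem lintegral_processLaw_zero (f : Coloring V → ℝ≥0∞) :
    ∫⁻ ω, f (ω 0) ∂(processLaw K c₀) = f c₀ := by
  have hf : Measurable f := measurable_of_countable f
  have hg : Measurable fun h : (i : Finset.Iic 0) → (fun _ : ℕ => Coloring V) i =>
      f (h ⟨0, Finset.mem_Iic.2 le_rfl⟩) := hf.comp (measurable_pi_apply _)
  have h1 : (processLaw K c₀).map (Preorder.frestrictLe 0) =
      (Measure.dirac c₀).map
        (MeasurableEquiv.piUnique fun i : Finset.Iic 0 => (fun _ : ℕ => Coloring V) i).symm := by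
    rw [processLaw, Kernel.trajMeasure, Measure.map_comp _ _ (by fun_prop),
      Kernel.traj_map_frestrictLe, Kernel.partialTraj_self, Measure.id_comp]
  have h2 := congrArg (fun μ => ∫⁻ h, f (h ⟨0, Finset.mem_Iic.2 le_rfl⟩) ∂μ) h1
  simp only at h2
  rw [lintegral_map hg (by fun_prop), lintegral_map hg (by fun_prop), lintegral_dirac] at h2
  exact h2

/-- The Markov property in the only form needed: together with the value at time 0 it determines the
law of each state, without reference to the history. -/
theorem lintegral_processLaw_succ (f : Coloring V → ℝ≥0∞) (t : ℕ) :
    ∫⁻ ω, f (ω (t + 1)) ∂(processLaw K c₀) =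
      ∫⁻ ω, ∫⁻ d, f d ∂(K (ω t)) ∂(processLaw K c₀) := by
  have hf : Measurable f := measurable_of_countable f
  have hg : Measurable fun x : ((i : Finset.Iic t) → (fun _ : ℕ => Coloring V) i) × Coloring V =>
      f x.2 := hf.comp measurable_snd
  have h1 := Kernel.map_frestrictLe_trajMeasure_compProd_eq_map_trajMeasure
    (X := fun _ => Coloring V) (μ₀ := Measure.dirac c₀) (κ := transition K) (a := t)
  have h2 := congrArg (fun μ => ∫⁻ x, f x.2 ∂μ) h1
  rw [Measure.lintegral_compProd hg, lintegral_map hg (by fun_prop),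
    lintegral_map (hg.lintegral_kernel_prod_right' ) (by fun_prop)] at h2
  exact h2.symm

end MarkovChain

/-- Every time before stabilization is unstable. Counting the unstable times turns the expected
stabilization time into a sum of one-time expectations. -/
theorem pathStabilizationTime_le_tsum {V : Type*} [Fintype V] (G : SimpleGraph V)
    (ω : ℕ → Coloring V) :
    (pathStabilizationTime G ω : ℝ≥0∞) ≤
      ∑' t, {d | ¬ IsStableState G d}.indicator (1 : Coloring V → ℝ≥0∞) (ω t) := by
  by_cases h : ∃ t, IsStableState G (ω t)
  · classical
    have h1 : pathStabilizationTime G ω ≤ (Nat.find h : ℕ) :=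
      iInf₂_le (f := fun t (_ : t ∈ {t : ℕ | IsStableState G (ω t)}) => (t : ℕ∞)) _ (Nat.find_spec h)
    calc (pathStabilizationTime G ω : ℝ≥0∞) ≤ ((Nat.find h : ℕ∞) : ℝ≥0∞) := by exact_mod_cast h1
      _ = ∑ t ∈ Finset.range (Nat.find h),
          {d | ¬ IsStableState G d}.indicator (1 : Coloring V → ℝ≥0∞) (ω t) := by
        rw [Finset.sum_congr rfl fun t ht => Set.indicator_of_mem
          (show ω t ∈ {d | ¬ IsStableState G d} from Nat.find_min h (Finset.mem_range.1 ht)) _]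
        simp
      _ ≤ _ := ENNReal.sum_le_tsum _
  · push Not at h
    have : ∀ t, {d | ¬ IsStableState G d}.indicator (1 : Coloring V → ℝ≥0∞) (ω t) = 1 :=
      fun t => Set.indicator_of_mem (show ω t ∈ {d | ¬ IsStableState G d} from h t) _
    simp [this]

namespace IsForced

variable {V : Type*} {G : SimpleGraph V} {c : ℕ → Coloring V} {v : ℕ → V} {T : ℕ}

/-- The number of steps that the synchronous process needs from `d` to a stable state. -/
noncomputable def remaining (G : SimpleGraph V) (d : Coloring V) : ℕ :=
  sInf {r | IsStableState G ((fun e => switch e (switchable G e))^[r] d)}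

theorem iterate_eq (h : IsForced G c v T) {r t : ℕ} (ht : t + r ≤ T) :
    (fun e => switch e (switchable G e))^[r] (c t) = c (t + r) := by
  induction r generalizing t with
  | zero => rfl
  | succ r ih =>
    rw [Function.iterate_succ_apply, h.switchable_eq t (by omega), ← h.step t (by omega),
      ih (by omega)]
    congr 1
    omega

theorem remaining_eq (h : IsForced G c v T) {t : ℕ} (ht : t ≤ T) :
    remaining G (c t) = T - t := by
  have hmem : T - t ∈ {r | IsStableState G ((fun e => switch e (switchable G e))^[r] (c t))} := by
    change IsStableState G _
    rw [h.iterate_eq (by omega), show t + (T - t) = T by omega]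
    exact h.stable
  refine le_antisymm (Nat.sInf_le hmem) (le_csInf ⟨_, hmem⟩ fun r hr => ?_)
  by_contra hlt
  change IsStableState G _ at hr
  rw [h.iterate_eq (by omega)] at hr
  have := h.eq_of_isStableState (by omega) hr
  omega

variable [Fintype V]

/-- A Markov chain that, along a forced trajectory, makes the next step with probability `p` and
stays with probability `1 - p`, follows the trajectory, and stabilizes in finite expected time. -/
theorem processLaw_of_lazy (h : IsForced G c v T) (K : Coloring V → Measure (Coloring V))
    [∀ c, IsProbabilityMeasure (K c)] {p p' : ℝ≥0∞} (hp : p ≠ 0) (hpp : p + p' = 1)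
    (hK : ∀ t < T, ∀ f : Coloring V → ℝ≥0∞, ∫⁻ d, f d ∂(K (c t)) = p * f (c (t + 1)) + p' * f (c t))
    (hT : ∀ f : Coloring V → ℝ≥0∞, ∫⁻ d, f d ∂(K (c T)) = f (c T)) :
    (∀ᵐ ω ∂(processLaw K (c 0)), (T : ℝ≥0∞) ≤ (pathStabilizationTime G ω : ℝ≥0∞)) ∧
      ∫⁻ ω, (pathStabilizationTime G ω : ℝ≥0∞) ∂(processLaw K (c 0)) < ⊤ := by
  have hmeas : ∀ (f : Coloring V → ℝ≥0∞) (t : ℕ), Measurable fun ω : ℕ → Coloring V => f (ω t) :=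
    fun f t => (measurable_of_countable f).comp (measurable_pi_apply t)
  -- Each step advances by at most one index, so at time `t` the chain is almost surely in some `c
  -- i` with `i ≤ t`. This already gives the lower bound.
  have hsupp : ∀ t, ∀ᵐ ω ∂(processLaw K (c 0)), ∃ i ≤ T, i ≤ t ∧ ω t = c i := by
    intro t
    have key : ∫⁻ ω, {d | ¬ ∃ i ≤ T, i ≤ t ∧ d = c i}.indicator (1 : Coloring V → ℝ≥0∞) (ω t)
        ∂(processLaw K (c 0)) = 0 := by
      induction t with
      | zero =>
        rw [lintegral_processLaw_zero]
        exact Set.indicator_of_notMem (not_not.2 ⟨0, Nat.zero_le T, le_rfl, rfl⟩) _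
      | succ t ih =>
        rw [lintegral_processLaw_succ]
        rw [lintegral_eq_zero_iff (hmeas _ t)] at ih
        refine lintegral_eq_zero_of_ae_eq_zero ?_
        filter_upwards [ih] with ω hω
        have hω' : ∃ i ≤ T, i ≤ t ∧ ω t = c i := by
          by_contra hcon
          have hmem : ω t ∈ {d | ¬ ∃ i ≤ T, i ≤ t ∧ d = c i} := hcon
          exact one_ne_zero ((Set.indicator_of_mem hmem _).symm.trans hω)
        obtain ⟨i, hiT, hit, hi⟩ := hω'
        have hz : ∀ j ≤ T, j ≤ t + 1 →
            {d | ¬ ∃ i ≤ T, i ≤ t + 1 ∧ d = c i}.indicator (1 : Coloring V → ℝ≥0∞) (c j) = 0 :=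
          fun j hj hj' => Set.indicator_of_notMem (not_not.2 ⟨j, hj, hj', rfl⟩) _
        rw [hi]
        rcases hiT.lt_or_eq with hlt | rfl
        · rw [hK i hlt, hz i hiT (by omega), hz (i + 1) hlt (by omega)]
          simp
        · rw [hT, hz i hiT (by omega)]
          rfl
    rw [lintegral_eq_zero_iff (hmeas _ t)] at key
    filter_upwards [key] with ω hω
    by_contra hcon
    have hmem : ω t ∈ {d | ¬ ∃ i ≤ T, i ≤ t ∧ d = c i} := hcon
    exact one_ne_zero ((Set.indicator_of_mem hmem _).symm.trans hω)
  refine ⟨?_, ?_⟩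
  · filter_upwards [ae_all_iff.2 hsupp] with ω hω
    have : (T : ℕ∞) ≤ pathStabilizationTime G ω := by
      refine le_iInf₂ fun t ht => ?_
      obtain ⟨i, hiT, hit, hi⟩ := hω t
      have ht' : IsStableState G (ω t) := ht
      rw [hi] at ht'
      obtain rfl := h.eq_of_isStableState hiT ht'
      exact_mod_cast hit
    exact_mod_cast this
  · set P := processLaw K (c 0) with hP
    set u : Coloring V → ℝ≥0∞ := {d | ¬ IsStableState G d}.indicator 1 with hu
    -- The potential is the number of remaining steps. It is a function of the state, so no
    -- distinctness of the states `c i` has to be proved first.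
    set g : Coloring V → ℝ≥0∞ := fun d => remaining G d with hg
    -- In an unstable state the potential drops by one with probability `p`. Telescoping bounds the
    -- expected number of unstable times by `T / p`.
    have hstep : ∀ t, ∫⁻ ω, g (ω (t + 1)) ∂P + p * ∫⁻ ω, u (ω t) ∂P ≤ ∫⁻ ω, g (ω t) ∂P := by
      intro t
      rw [hP, lintegral_processLaw_succ, ← lintegral_const_mul _ (hmeas _ t),
        ← lintegral_add_right _ ((hmeas _ t).const_mul _)]
      refine lintegral_mono_ae ?_
      filter_upwards [hsupp t] with ω hω
      obtain ⟨i, hiT, -, hi⟩ := hω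
      rw [hi]
      rcases hiT.lt_or_eq with hlt | rfl
      · have hui : u (c i) = 1 := Set.indicator_of_mem
          (show c i ∈ {d | ¬ IsStableState G d} from
            fun hs => hlt.ne (h.eq_of_isStableState hiT hs)) _
        have hgi : g (c i) = g (c (i + 1)) + 1 := by
          simp only [hg, h.remaining_eq hiT, h.remaining_eq hlt]
          exact_mod_cast (by omega : T - i = T - (i + 1) + 1)
        rw [hK i hlt, hui, hgi, mul_add, mul_one, ← add_assoc, ← add_mul, hpp, one_mul, add_assoc,
          mul_one, add_comm p', hpp]
      · have hui : u (c i) = 0 := Set.indicator_of_notMem (not_not.2 h.stable) _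
        rw [hT, hui]
        simp
    have hsum : ∀ N, ∫⁻ ω, g (ω N) ∂P + p * ∑ t ∈ Finset.range N, ∫⁻ ω, u (ω t) ∂P ≤ T := by
      intro N
      induction N with
      | zero =>
        rw [hP, lintegral_processLaw_zero]
        simp [hg, h.remaining_eq (Nat.zero_le T)]
      | succ N ih =>
        rw [Finset.sum_range_succ, mul_add, add_comm (p * _), ← add_assoc]
        exact (add_le_add_left (hstep N) _).trans ih
    calc ∫⁻ ω, (pathStabilizationTime G ω : ℝ≥0∞) ∂P
        ≤ ∫⁻ ω, ∑' t, u (ω t) ∂P := lintegral_mono fun ω => pathStabilizationTime_le_tsum G ω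
      _ = ∑' t, ∫⁻ ω, u (ω t) ∂P := lintegral_tsum fun t => (hmeas u t).aemeasurable
      _ ≤ T / p := by
        rw [ENNReal.tsum_eq_iSup_nat]
        refine iSup_le fun N => ?_
        have hp' : p ≠ ⊤ := ne_top_of_le_ne_top ENNReal.one_ne_top (hpp ▸ le_self_add)
        rw [ENNReal.le_div_iff_mul_le (Or.inl hp) (Or.inl hp'), mul_comm]
        exact le_add_self.trans (hsum N)
      _ < ⊤ := ENNReal.div_lt_top (ENNReal.natCast_ne_top T) hp

theorem processLaw_sequentialRandomStep (h : IsForced G c v T) :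
    (∀ᵐ ω ∂(processLaw (sequentialRandomStep G) (c 0)),
      (T : ℝ≥0∞) ≤ (pathStabilizationTime G ω : ℝ≥0∞)) ∧
      ∫⁻ ω, (pathStabilizationTime G ω : ℝ≥0∞) ∂(processLaw (sequentialRandomStep G) (c 0)) < ⊤ := by
  classical
  refine h.processLaw_of_lazy _ (p := 1) (p' := 0) one_ne_zero (by simp) ?_ ?_
  · intro t ht f
    have hs := h.switchable_eq t ht
    have hstep : sequentialRandomStep G (c t) = Measure.dirac (c (t + 1)) := by
      have hne : (switchable G (c t)).toFinset.Nonempty := by simp [hs]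
      have hpure : PMF.uniformOfFinset (switchable G (c t)).toFinset hne = PMF.pure (v t) := by
        ext x
        simp [PMF.uniformOfFinset_apply, PMF.pure_apply, hs]
      rw [sequentialRandomStep, dif_pos]
      · convert PMF.toMeasure_pure (c (t + 1)) using 2
        · rw [h.step t ht, ← PMF.pure_map (fun v => switch (c t) {v}) (v t), ← hpure]
    rw [hstep, lintegral_dirac]
    simp
  · intro f
    have hs : switchable G (c T) = ∅ := h.stable
    rw [sequentialRandomStep, dif_neg (by simp [hs]), lintegral_dirac]

theorem switch_empty {V : Type*} (c : Coloring V) : switch c ∅ = c := by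
  funext v
  simp [switch]

theorem processLaw_concurrentRandomStep (h : IsForced G c v T) (p : unitInterval) (hp : 0 < p) :
    (∀ᵐ ω ∂(processLaw (concurrentRandomStep p G) (c 0)),
      (T : ℝ≥0∞) ≤ (pathStabilizationTime G ω : ℝ≥0∞)) ∧
      ∫⁻ ω, (pathStabilizationTime G ω : ℝ≥0∞) ∂(processLaw (concurrentRandomStep p G) (c 0)) < ⊤ := by
  classical
  refine h.processLaw_of_lazy _ (p := (unitInterval.toNNReal p : ℝ≥0∞))
    (p' := (unitInterval.toNNReal (unitInterval.symm p) : ℝ≥0∞)) ?_ ?_ ?_ ?_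
  · rw [Ne, ENNReal.coe_eq_zero, ← NNReal.coe_eq_zero]
    exact fun h0 => hp.ne' (Subtype.ext h0)
  · rw [← ENNReal.coe_add, ← ENNReal.coe_one, ENNReal.coe_inj]
    exact NNReal.eq (add_sub_cancel (p : ℝ) 1)
  · intro t ht f
    have hf : Measurable f := measurable_of_countable f
    rw [concurrentRandomStep, lintegral_map hf (measurable_switch _), h.switchable_eq t ht,
      lintegral_fintype, Finset.sum_eq_add {v t} ∅ (Set.singleton_ne_empty _)]
    · rw [setBernoulli_singleton p le_rfl (Set.finite_singleton _),
        setBernoulli_singleton p (Set.empty_subset _) (Set.finite_singleton _), switch_empty,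
        ← h.step t ht]
      simp [mul_comm]
    · intro S _ hS
      rw [setBernoulli_singleton_of_not_subset, mul_zero]
      rw [Set.subset_singleton_iff_eq]
      tauto
    · simp
    · simp
  · intro f
    have hf : Measurable f := measurable_of_countable f
    rw [concurrentRandomStep, lintegral_map hf (measurable_switch _),
      show switchable G (c T) = ∅ from h.stable, setBernoulli_empty, lintegral_dirac, switch_empty]

end IsForced

/-! ### Spins, and biases realized by nodes that never switch -/

/-- The spin `1` or `-1` of a color. -/
def spin (x : Bool) : ℤ := if x then 1 else -1

theorem spin_mul_self (x : Bool) : spin x * spin x = 1 := by cases x <;> rfl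

theorem spin_eq_one_or (x : Bool) : spin x = 1 ∨ spin x = -1 := by cases x <;> simp [spin]

open Classical in
/-- The integer `1` if `P` holds, and `0` otherwise. -/
noncomputable def ind (P : Prop) : ℤ := if P then 1 else 0

theorem ind_pos {P : Prop} (h : P) : ind P = 1 := if_pos h

theorem ind_neg {P : Prop} (h : ¬P) : ind P = 0 := if_neg h

theorem ind_nonneg (P : Prop) : 0 ≤ ind P := by
  unfold ind
  split_ifs <;> simp

theorem balance_eq_sum {V : Type*} [Fintype V] (G : SimpleGraph V) (c : Coloring V) (v : V) :
    balance G c v = ∑ w, ind (G.Adj v w) * -(spin (c v) * spin (c w)) := by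
  classical
  have hcount : ∀ x, (colorCount G c v x : ℤ) = ∑ w, if G.Adj v w ∧ c w = x then 1 else 0 := by
    intro x
    rw [colorCount, Set.ncard_eq_toFinset_card', Finset.sum_boole]
    simp
  rw [balance, hcount, hcount, ← Finset.sum_sub_distrib]
  refine Finset.sum_congr rfl fun w _ => ?_
  by_cases h : G.Adj v w
  · cases c v <;> cases c w <;> simp [h, spin, ind]
  · simp [h, ind]

theorem balance_comap_equiv {V W : Type*} (e : V ≃ W) (G : SimpleGraph W) (c : Coloring W) (v : V) :
    balance (G.comap e) (c ∘ e) v = balance G c (e v) := by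
  have h : ∀ x, colorCount (G.comap e) (c ∘ e) v x = colorCount G c (e v) x := fun x =>
    Set.ncard_preimage_of_injective_subset_range (s := {w | G.Adj (e v) w ∧ c w = x}) e.injective
      (by simp)
  simp [balance, h]

section Bias

variable {V : Type*}

/-- The graph `G` with additional nodes: a complete bipartite graph with parts of size `s`, whose
nodes never switch and serve to bias each node `v` of `G` with strength `h v`, and `r` isolated
nodes. -/
def biasedGraph (G : SimpleGraph V) (h : V → ℤ) (s r : ℕ) :
    SimpleGraph (V ⊕ (Bool × Fin s) ⊕ Fin r) where
  Adj
    | .inl v, .inl w => G.Adj v w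
    | .inl v, .inr (.inl (x, u)) => (u : ℕ) < (h v).natAbs ∧ x = decide (h v < 0)
    | .inr (.inl (x, u)), .inl v => (u : ℕ) < (h v).natAbs ∧ x = decide (h v < 0)
    | .inr (.inl (x, _)), .inr (.inl (y, _)) => x ≠ y
    | _, _ => False
  symm := ⟨by
    rintro (v | (x | x)) (w | (y | y)) <;> simp +contextual [G.adj_comm, eq_comm]⟩
  loopless := ⟨by rintro (v | (x | x)) <;> simp⟩

/-- The coloring of `biasedGraph` that extends a coloring of `G`. -/
def biasedColoring (c : Coloring V) (s r : ℕ) : Coloring (V ⊕ (Bool × Fin s) ⊕ Fin r)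
  | .inl v => c v
  | .inr (.inl (x, _)) => x
  | .inr (.inr _) => false

/-- The balance of a node in a graph in which the nodes are biased by `h`. -/
noncomputable def biasedBalance [Fintype V] (G : SimpleGraph V) (h : V → ℤ) (c : Coloring V)
    (v : V) : ℤ :=
  spin (c v) * (h v - ∑ w, ind (G.Adj v w) * spin (c w))

variable [Fintype V] (G : SimpleGraph V) (h : V → ℤ) (c : Coloring V) (s r : ℕ)

/-- Node `v` is joined to `|h v|` auxiliary nodes, whose color is black for positive and white for
negative bias; these contribute exactly `spin (c v) * h v`. -/
theorem balance_biasedGraph_inl (v : V) (hs : (h v).natAbs ≤ s) :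
    balance (biasedGraph G h s r) (biasedColoring c s r) (.inl v) = biasedBalance G h c v := by
  classical
  have hfix : ∑ x : Bool × Fin s,
      ind ((x.2 : ℕ) < (h v).natAbs ∧ x.1 = decide (h v < 0)) * -(spin (c v) * spin x.1) =
      spin (c v) * h v := by
    rw [Fintype.sum_prod_type_right]
    have h1 : ∀ u : Fin s, ∑ x : Bool,
        ind ((u : ℕ) < (h v).natAbs ∧ x = decide (h v < 0)) * -(spin (c v) * spin x) =
        if (u : ℕ) < (h v).natAbs then -(spin (c v) * spin (decide (h v < 0))) else 0 := by
      intro u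
      by_cases hu : (u : ℕ) < (h v).natAbs
      · by_cases hv : h v < 0 <;> simp [hu, hv, ind]
      · simp [hu, ind]
    rw [Finset.sum_congr rfl fun u _ => h1 u, Fin.sum_univ_eq_sum_range
      (fun u => if u < (h v).natAbs then -(spin (c v) * spin (decide (h v < 0))) else 0),
      ← Finset.sum_filter]
    have h2 : (Finset.range s).filter (fun u => u < (h v).natAbs) =
        Finset.range (h v).natAbs := by
      ext u
      simp only [Finset.mem_filter, Finset.mem_range]
      omega
    rw [h2, Finset.sum_const, Finset.card_range, nsmul_eq_mul, Int.natCast_natAbs]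
    by_cases hv : h v < 0
    · rw [abs_of_neg hv, decide_eq_true hv, spin, spin, if_pos rfl]
      ring
    · rw [abs_of_nonneg (not_lt.1 hv), decide_eq_false hv, spin, spin, if_neg Bool.false_ne_true]
      ring
  rw [balance_eq_sum, Fintype.sum_sum_type, Fintype.sum_sum_type]
  simp only [biasedGraph, biasedColoring]
  rw [hfix, biasedBalance, mul_sub, Finset.mul_sum]
  simp only [ind_neg not_false, zero_mul, Finset.sum_const_zero, add_zero]
  rw [sub_eq_add_neg, ← Finset.sum_neg_distrib, add_comm]
  congr 1
  exact Finset.sum_congr rfl fun w _ => by ring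

/-- An auxiliary node has `s` neighbors of the opposite color in the other part, which outweigh its
at most `Fintype.card V` neighbors in `V`, whatever their colors. -/
theorem balance_biasedGraph_inr_nonneg (x : (Bool × Fin s) ⊕ Fin r) (hs : Fintype.card V ≤ s) :
    0 ≤ balance (biasedGraph G h s r) (biasedColoring c s r) (.inr x) := by
  classical
  rw [balance_eq_sum, Fintype.sum_sum_type, Fintype.sum_sum_type]
  rcases x with ⟨x, u⟩ | x
  · simp only [biasedGraph, biasedColoring]
    have h1 : ∑ y : Bool × Fin s, ind (x ≠ y.1) * -(spin x * spin y.1) = s := by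
      rw [Fintype.sum_prod_type]
      cases x <;> simp [spin, ind]
    have h2 : -(Fintype.card V : ℤ) ≤ ∑ w : V,
        ind ((u : ℕ) < (h w).natAbs ∧ x = decide (h w < 0)) * -(spin x * spin (c w)) := by
      rw [show -(Fintype.card V : ℤ) = ∑ _w : V, (-1 : ℤ) by simp]
      refine Finset.sum_le_sum fun w _ => ?_
      unfold ind
      split_ifs
      · cases x <;> cases c w <;> simp [spin]
      · simp
    rw [h1]
    simp only [ind_neg not_false, zero_mul, Finset.sum_const_zero]
    have : (Fintype.card V : ℤ) ≤ s := by exact_mod_cast hs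
    linarith
  · simp [biasedGraph, ind]

end Bias

/-- A trajectory of a biased graph in which in each step the unique node with negative balance
switches is realized in a graph on `Fin n`. -/
theorem exists_isForced_of_biasedBalance {V : Type*} [Fintype V] (G : SimpleGraph V) (h : V → ℤ)
    (c : ℕ → Coloring V) (v : ℕ → V) (T n : ℕ) (hh : ∀ x, (h x).natAbs ≤ Fintype.card V)
    (hn : 3 * Fintype.card V ≤ n)
    (hneg : ∀ t < T, ∀ x, biasedBalance G h (c t) x < 0 ↔ x = v t)
    (hstep : ∀ t < T, c (t + 1) = switch (c t) {v t})
    (hstable : ∀ x, 0 ≤ biasedBalance G h (c T) x) :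
    ∃ (G' : SimpleGraph (Fin n)) (c' : ℕ → Coloring (Fin n)) (f : V ↪ Fin n),
      IsForced G' c' (f ∘ v) T ∧ (∀ x y, G.Adj x y → G'.Adj (f x) (f y)) ∧
      (∀ t x, c' t (f x) = c t x) ∧ ∀ t x, balance G' (c' t) (f x) = biasedBalance G h (c t) x := by
  classical
  set s := Fintype.card V with hs
  obtain ⟨r, rfl⟩ := Nat.exists_eq_add_of_le hn
  have e : Fin (3 * s + r) ≃ V ⊕ (Bool × Fin s) ⊕ Fin r :=
    Fintype.equivOfCardEq (by simp [← hs]; ring)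
  set G' := (biasedGraph G h s r).comap e
  set c' : ℕ → Coloring (Fin (3 * s + r)) := fun t => biasedColoring (c t) s r ∘ e
  have hbal : ∀ t x, balance G' (c' t) (e.symm (.inl x)) = biasedBalance G h (c t) x := by
    intro t x
    rw [balance_comap_equiv, Equiv.apply_symm_apply, balance_biasedGraph_inl _ _ _ _ _ _ (hh x)]
  have hfix : ∀ t x, 0 ≤ balance G' (c' t) (e.symm (.inr x)) := by
    intro t x
    rw [balance_comap_equiv, Equiv.apply_symm_apply]
    exact balance_biasedGraph_inr_nonneg _ _ _ _ _ _ hs.le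
  let f : V ↪ Fin (3 * s + r) := ⟨fun x => e.symm (.inl x), fun x y hxy => Sum.inl_injective
    (e.symm.injective hxy)⟩
  have hf : ∀ x, f x = e.symm (.inl x) := fun _ => rfl
  refine ⟨G', c', f, ⟨?_, ?_, ?_⟩, ?_, ?_, hbal⟩
  · intro t ht
    ext y
    obtain ⟨x | x, rfl⟩ := e.symm.surjective y
    · rw [mem_switchable_iff_balance_neg, hbal, hneg t ht]
      simp [hf]
    · rw [mem_switchable_iff_balance_neg, ← not_le, iff_false_intro (not_not.2 (hfix t x))]
      simp [hf]
  · intro t ht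
    funext y
    obtain ⟨x | x, rfl⟩ := e.symm.surjective y
    · simp [c', biasedColoring, hstep t ht, switch, hf]
    · rcases x with x | x <;> simp [c', biasedColoring, switch, hf]
  · rw [IsStableState, Set.eq_empty_iff_forall_notMem]
    intro y
    rw [mem_switchable_iff_balance_neg, not_lt]
    obtain ⟨x | x, rfl⟩ := e.symm.surjective y
    · rw [hbal]
      exact hstable x
    · exact hfix T x
  · intro x y hxy
    simpa [G', biasedGraph, hf] using hxy
  · intro t x
    simp [c', biasedColoring, hf]

/-! ### The relay network and its phases -/

/-- The color that stands for the parity of `x`. -/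
def parityColor (x : ℕ) : Bool := decide (x % 2 = 0)

theorem spin_parityColor (x : ℕ) : spin (parityColor x) = if x % 2 = 0 then 1 else -1 := by
  simp [spin, parityColor]

theorem spin_parityColor_mul (x y : ℕ) :
    spin (parityColor x) * spin (parityColor y) = if (x + y) % 2 = 0 then 1 else -1 := by
  rw [spin_parityColor, spin_parityColor]
  split_ifs <;> first | rfl | omega

theorem parityColor_eq_iff {x y : ℕ} : parityColor x = parityColor y ↔ x % 2 = y % 2 := by
  unfold parityColor
  rw [decide_eq_decide]
  omega

theorem parityColor_eq_not_iff {x y : ℕ} : parityColor x = !parityColor y ↔ x % 2 ≠ y % 2 := by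
  unfold parityColor
  rw [← decide_not, decide_eq_decide]
  omega

theorem sum_fin_ind_eq {n : ℕ} (x : ℕ) (g : ℕ → ℤ) :
    ∑ i : Fin n, ind ((i : ℕ) = x) * g i = if x < n then g x else 0 := by
  rw [Fin.sum_univ_eq_sum_range (fun i => ind (i = x) * g i)]
  simp [ind]

theorem ind_or {P Q : Prop} (h : ¬(P ∧ Q)) : ind (P ∨ Q) = ind P + ind Q := by
  by_cases hP : P <;> by_cases hQ : Q <;> simp_all [ind]

theorem ind_or_le (P Q : Prop) : ind (P ∨ Q) ≤ ind P + ind Q := by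
  by_cases hP : P <;> by_cases hQ : Q <;> simp_all [ind]

theorem ind_and (P Q : Prop) : ind (P ∧ Q) = ind P * ind Q := by
  by_cases hP : P <;> by_cases hQ : Q <;> simp_all [ind]

theorem ind_le_one (P : Prop) : ind P ≤ 1 := by
  by_cases hP : P <;> simp [ind, hP]

/-- Admissible sizes of the relay network: `k` rounds, in each of which `a` charging nodes, `b`
upper nodes and all the `m` base nodes switch. -/
structure Admissible (a b m k w : ℕ) : Prop where
  odd_a : a % 2 = 1
  even_b : b % 2 = 0
  odd_k : k % 2 = 1
  four_le_b : 4 ≤ b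
  one_le_w : 1 ≤ w
  le_a : 2 * w + 5 ≤ a
  m_eq : m = b * w

theorem Admissible.m_bounds {a b m k w : ℕ} (h : Admissible a b m k w) : m % 2 = 0 ∧ 4 ≤ m := by
  rw [h.m_eq]
  exact ⟨by simp [Nat.mul_mod, h.even_b], by nlinarith [h.four_le_b, h.one_le_w]⟩

/-- Nodes of the relay network: `m` base nodes, and for each of `k` rounds `a` charging nodes
followed by `b` upper nodes. -/
abbrev RelayNode (a b m k : ℕ) := Fin m ⊕ (Fin k × Fin (a + b))

/-- Adjacency between the charging and upper nodes. -/
def controlAdj (a j i j' i' : ℕ) : Prop :=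
  (j = j' ∧ (i + 1 = i' ∨ i' + 1 = i ∨
    ((i + i') % 2 = 1 ∧ (i < a ∧ a ≤ i' ∨ i' < a ∧ a ≤ i)))) ∨
  (i = 0 ∧ i' = 0 ∧ (j + 1 = j' ∨ j' + 1 = j))

/-- Adjacency between a charging or upper node `i` (of any round) and a base node `l`. -/
def controlBaseAdj (a b m i l : ℕ) : Prop :=
  i = a + (l + 1) % b ∨ (i + 1 = a + b ∧ l = 0) ∨ (i = 0 ∧ l + 1 = m)

/-- The relay network. -/
def relayGraph (a b m k : ℕ) : SimpleGraph (RelayNode a b m k) where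
  Adj
    | .inl l, .inl l' => (l : ℕ) + 1 = l' ∨ (l' : ℕ) + 1 = l
    | .inl l, .inr (_, i) => controlBaseAdj a b m i l
    | .inr (_, i), .inl l => controlBaseAdj a b m i l
    | .inr (j, i), .inr (j', i') => controlAdj a j i j' i'
  symm := ⟨by
    rintro (l | ⟨j, i⟩) (l' | ⟨j', i'⟩) h
    · exact Or.symm h
    · exact h
    · exact h
    · unfold controlAdj at h ⊢
      omega⟩
  loopless := ⟨by
    rintro (l | ⟨j, i⟩) h
    · simp at h
    · unfold controlAdj at h
      omega⟩

/-- In phase `(J, p)`, the control node `i` of round `j` has already switched. -/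
def Flipped (J p j i : ℕ) : Prop := j + 1 < J ∨ (j + 1 = J ∧ i < p)

/-- The phase parity of position `x` in phase `(J, p)`. -/
noncomputable def phase (J p x : ℕ) : ℕ := x + J + if x < p then 1 else 0

open Classical in
/-- The coloring of the relay network in phase `(J, p)`, that is, when the node in position `p` of
round `J` is about to switch. -/
noncomputable def phaseColoring (a b m k J p : ℕ) : Coloring (RelayNode a b m k)
  | .inl l => parityColor (phase J p (a + b + l))
  | .inr (j, i) => parityColor (i + j + 1 + if Flipped J p j i then 1 else 0)

/-- The phases that occur. -/
structure IsPhase (a b m k J p : ℕ) : Prop where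
  lt : p < a + b + m
  zero : J = 0 → a + b ≤ p
  le : J ≤ k + 1
  last : J = k + 1 → p = 0

/-- The node that is about to switch in phase `(J, p)`. -/
def IsNext {a b m k : ℕ} (J p : ℕ) : RelayNode a b m k → Prop
  | .inl l => a + b + l = p
  | .inr (j, i) => (j : ℕ) + 1 = J ∧ (i : ℕ) = p

variable {a b m k w J p : ℕ}

/-! ### Balances of the base nodes -/

theorem sum_alternating (J k : ℕ) :
    ∑ j ∈ Finset.range k, (if (j + 1 + if j < J then 1 else 0) % 2 = 0 then (1 : ℤ) else -1) =
      if k ≤ J then ((k % 2 : ℕ) : ℤ)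
      else ((J % 2 : ℕ) : ℤ) + (if J % 2 = 0 then -1 else 1) * (((k - J) % 2 : ℕ) : ℤ) := by
  induction k with
  | zero => simp
  | succ k ih =>
    rw [Finset.sum_range_succ, ih]
    split_ifs <;> omega

/-- Copies of one position in different rounds have alternating colors except at the border between
switched and unswitched copies. As `k` is odd, the sum is a single spin, and it flips whenever the
copy of the current round switches. -/
theorem sum_spin_control (h : Admissible a b m k w) (hp : IsPhase a b m k J p)
    (i : Fin (a + b)) :
    ∑ j : Fin k, spin (phaseColoring a b m k J p (.inr (j, i))) =
      spin (parityColor (phase J p i)) := by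
  classical
  have hk := h.odd_k
  obtain ⟨h1, h2, h3, h4⟩ := hp
  have hi := i.2
  -- `J'` is the number of copies of position `i` that have switched. In round 0 every control
  -- position counts as already passed (`IsPhase.zero`), which keeps the formula valid there.
  obtain ⟨J', hJ', hk', hfl⟩ : ∃ J', J' + 1 = (J + if (i : ℕ) < p then 1 else 0) ∧ J' ≤ k ∧
      ∀ j, Flipped J p j i ↔ j < J' := by
    unfold Flipped
    by_cases hip : (i : ℕ) < p
    · exact ⟨J, by simp [hip], by omega, by omega⟩
    · exact ⟨J - 1, by simp only [hip, if_false]; omega, by omega, by omega⟩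
  have hterm : ∀ j : Fin k, spin (phaseColoring a b m k J p (.inr (j, i))) =
      spin (parityColor i) *
        (if ((j : ℕ) + 1 + if (j : ℕ) < J' then 1 else 0) % 2 = 0 then (1 : ℤ) else -1) := by
    intro j
    simp only [phaseColoring, hfl, spin_parityColor]
    split_ifs <;> omega
  rw [Finset.sum_congr rfl fun j _ => hterm j, ← Finset.mul_sum, Fin.sum_univ_eq_sum_range
    (fun j => if (j + 1 + if j < J' then 1 else 0) % 2 = 0 then (1 : ℤ) else -1), sum_alternating]
  unfold phase
  rw [add_assoc, ← hJ', spin_parityColor, spin_parityColor]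
  split_ifs <;> omega

theorem sum_neighbors_base (h : Admissible a b m k w) (hp : IsPhase a b m k J p) (l : Fin m) :
    ∑ x, ind ((relayGraph a b m k).Adj (.inl l) x) * spin (phaseColoring a b m k J p x) =
      spin (parityColor (phase J p (a + b + l - 1))) +
      spin (parityColor (phase J p (if (l : ℕ) + 1 = m then 0 else a + b + l + 1))) +
      spin (parityColor (phase J p (a + (l + 1) % b))) := by
  have hb := h.four_le_b
  have ha := h.le_a
  have hl := l.2
  have hmod : ((l : ℕ) + 1) % b < b := Nat.mod_lt _ (by omega)
  set ψ : ℕ → ℤ := fun x => spin (parityColor (phase J p x)) with hψ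
  rw [Fintype.sum_sum_type, Fintype.sum_prod_type_right]
  have hbase : ∑ l' : Fin m, ind ((relayGraph a b m k).Adj (.inl l) (.inl l')) *
      spin (phaseColoring a b m k J p (.inl l')) =
      (if (l : ℕ) + 1 < m then ψ (a + b + (l + 1)) else 0) +
        (if 0 < (l : ℕ) then ψ (a + b + (l - 1)) else 0) := by
    have h1 : ∀ l' : Fin m, ind ((relayGraph a b m k).Adj (.inl l) (.inl l')) *
      spin (phaseColoring a b m k J p (.inl l')) =
        ind ((l' : ℕ) = l + 1) * ψ (a + b + l') +
          ind (0 < (l : ℕ)) * (ind ((l' : ℕ) = l - 1) * ψ (a + b + l')) := by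
      intro l'
      have h2 : (relayGraph a b m k).Adj (.inl l) (.inl l') ↔
          ((l' : ℕ) = l + 1 ∨ (0 < (l : ℕ) ∧ (l' : ℕ) = l - 1)) := by
        change ((l : ℕ) + 1 = l' ∨ (l' : ℕ) + 1 = l) ↔ _
        omega
      rw [h2, ind_or (by omega), ind_and]
      simp only [phaseColoring, hψ]
      ring
    rw [Finset.sum_congr rfl fun l' _ => h1 l', Finset.sum_add_distrib, ← Finset.mul_sum,
      sum_fin_ind_eq _ (fun x => ψ (a + b + x)), sum_fin_ind_eq _ (fun x => ψ (a + b + x)),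
      if_pos (show (l : ℕ) - 1 < m by omega)]
    by_cases h0 : 0 < (l : ℕ) <;> simp [h0, ind]
  have hctrl : ∑ i : Fin (a + b), ∑ j : Fin k,
      ind ((relayGraph a b m k).Adj (.inl l) (.inr (j, i))) *
        spin (phaseColoring a b m k J p (.inr (j, i))) =
      ψ (a + (l + 1) % b) + ((if (l : ℕ) = 0 then ψ (a + b - 1) else 0) +
        (if (l : ℕ) + 1 = m then ψ 0 else 0)) := by
    have h1 : ∀ i : Fin (a + b), ∑ j : Fin k,
        ind ((relayGraph a b m k).Adj (.inl l) (.inr (j, i))) *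
          spin (phaseColoring a b m k J p (.inr (j, i))) =
        ind ((i : ℕ) = a + (l + 1) % b) * ψ i +
          (ind ((l : ℕ) = 0) * (ind ((i : ℕ) = a + b - 1) * ψ i) +
            ind ((l : ℕ) + 1 = m) * (ind ((i : ℕ) = 0) * ψ i)) := by
      intro i
      have h2 : ∀ j : Fin k, (relayGraph a b m k).Adj (.inl l) (.inr (j, i)) ↔
          ((i : ℕ) = a + (l + 1) % b ∨
            (((l : ℕ) = 0 ∧ (i : ℕ) = a + b - 1) ∨ ((l : ℕ) + 1 = m ∧ (i : ℕ) = 0))) := by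
        intro j
        change controlBaseAdj a b m i l ↔ _
        unfold controlBaseAdj
        omega
      -- The upper node of base node 0 must differ from its predecessor at position `a + b - 1`, so
      -- that the adjacency conditions are disjoint; this uses `4 ≤ b`.
      have h3 : (l : ℕ) = 0 → ((l : ℕ) + 1) % b = 1 := by
        intro h0
        rw [h0, Nat.mod_eq_of_lt (by omega)]
      simp only [h2]
      rw [← Finset.mul_sum, sum_spin_control h hp, ind_or (by omega), ind_or (by omega), ind_and,
        ind_and]
      simp only [hψ]
      ring
    rw [Finset.sum_congr rfl fun i _ => h1 i, Finset.sum_add_distrib, Finset.sum_add_distrib,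
      ← Finset.mul_sum, ← Finset.mul_sum, sum_fin_ind_eq, sum_fin_ind_eq, sum_fin_ind_eq,
      if_pos (by omega), if_pos (by omega), if_pos (by omega)]
    congr 1
    congr 1
    · by_cases h0 : (l : ℕ) = 0 <;> simp [h0, ind]
    · by_cases h0 : (l : ℕ) + 1 = m <;> simp [h0, ind]
  rw [hbase, hctrl]
  have e1 : (if 0 < (l : ℕ) then ψ (a + b + (l - 1)) else 0) +
      (if (l : ℕ) = 0 then ψ (a + b - 1) else 0) = ψ (a + b + l - 1) := by
    by_cases h0 : (l : ℕ) = 0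
    · simp [h0]
    · rw [if_pos (by omega), if_neg h0, add_zero]
      congr 1
      omega
  have e2 : (if (l : ℕ) + 1 < m then ψ (a + b + (l + 1)) else 0) +
      (if (l : ℕ) + 1 = m then ψ 0 else 0) =
      ψ (if (l : ℕ) + 1 = m then 0 else a + b + l + 1) := by
    by_cases h0 : (l : ℕ) + 1 = m
    · simp [h0]
    · rw [if_pos (by omega), if_neg h0, if_neg h0, add_zero]
      congr 1
  change _ = ψ _ + ψ _ + ψ _
  rw [← e1, ← e2]
  ring

-- The three terms come from the predecessor, the successor and the upper node. Neighboring
-- positions agree only while exactly one of them has switched in the round; the upper node agrees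
-- from its own switch until that of the base node. The sum is negative exactly at `p = a + b + l`.
open Classical in
theorem biasedBalance_base (h : Admissible a b m k w) (hp : IsPhase a b m k J p)
    (bias : RelayNode a b m k → ℤ) (l : Fin m) (hl : bias (.inl l) = 0) :
    biasedBalance (relayGraph a b m k) bias (phaseColoring a b m k J p) (.inl l) =
      (if p = a + b + l then -1 else 1) +
      (if (l : ℕ) + 1 = m ∧ p = 0 ∨ p = a + b + l + 1 then -1 else 1) +
      (if a + (l + 1) % b < p ∧ p ≤ a + b + l then -1 else 1) := by
  have hb := h.four_le_b
  have hb2 := h.even_b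
  have ha := h.le_a
  have ha2 := h.odd_a
  have hm2 := h.m_bounds.1
  have hl' := l.2
  have hplt := hp.lt
  have hmod : ((l : ℕ) + 1) % b < b := Nat.mod_lt _ (by omega)
  have hmod2 : ((l : ℕ) + 1) % b % 2 = (l + 1) % 2 := by
    rw [Nat.mod_mod_of_dvd _ (Nat.dvd_of_mod_eq_zero hb2)]
  rw [biasedBalance, sum_neighbors_base h hp, hl]
  simp only [phaseColoring]
  rw [zero_sub, mul_neg, mul_add, mul_add, neg_add, neg_add, spin_parityColor_mul,
    spin_parityColor_mul, spin_parityColor_mul]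
  congr 1
  · congr 1
    · unfold phase
      split_ifs <;> omega
    · unfold phase
      split_ifs <;> omega
  · unfold phase
    generalize ((l : ℕ) + 1) % b = r at *
    split_ifs <;> omega

/-! ### Control nodes are not switchable before or after their turn -/

/-- The contribution of the node `x` to the balance that a control node `i` of round `j` has before
it switches, in phase `(J, p)`. -/
noncomputable def support (a b m k j i J p : ℕ) (x : RelayNode a b m k) : ℤ :=
  -(spin (parityColor (i + j + 1)) * spin (phaseColoring a b m k J p x))

theorem support_bounds (a b m k j i J p : ℕ) (x : RelayNode a b m k) :
    -1 ≤ support a b m k j i J p x ∧ support a b m k j i J p x ≤ 1 := by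
  unfold support
  rcases spin_eq_one_or (parityColor (i + j + 1)) with h | h <;>
  rcases spin_eq_one_or (phaseColoring a b m k J p x) with h' | h' <;> simp [h, h']

-- Adjacent control nodes start with opposite colors, and each switches once: the support goes from
-- 1 to -1 and never returns.
open Classical in
theorem support_control {j i J p : ℕ} (j' : Fin k) (i' : Fin (a + b))
    (h : controlAdj a j i j' i') :
    support a b m k j i J p (.inr (j', i')) = if Flipped J p j' i' then -1 else 1 := by
  unfold controlAdj at h
  simp only [support, phaseColoring]
  rw [spin_parityColor_mul]
  split_ifs <;> omega

theorem support_base (j i J p : ℕ) (l : Fin m) :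
    support a b m k j i J p (.inl l) =
      if (i + j + 1 + (a + b + l + J + if a + b + l < p then 1 else 0)) % 2 = 0 then -1 else 1 := by
  simp only [support, phaseColoring, phase]
  rw [spin_parityColor_mul]
  split_ifs <;> rfl

/-- Upper nodes switch before the wave of their round, when their base neighbors still have the
opposite color. So at its turn an upper node has the largest possible support from the base. -/
theorem support_base_of_upper (h : Admissible a b m k w) {j i p : ℕ} {l : Fin m} (hi : a ≤ i)
    (hl : controlBaseAdj a b m i l) (hp : p ≤ i) (hib : i < a + b) :
    support a b m k j i (j + 1) p (.inl l) = 1 := by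
  have hb := h.four_le_b
  have hb2 := h.even_b
  have ha := h.le_a
  have ha2 := h.odd_a
  have hmod2 : ((l : ℕ) + 1) % b % 2 = (l + 1) % 2 := by
    rw [Nat.mod_mod_of_dvd _ (Nat.dvd_of_mod_eq_zero hb2)]
  unfold controlBaseAdj at hl
  rw [support_base]
  split_ifs <;> omega

/-- The node `(j, i)` changes its relation to its neighbors only in the direction of switching. -/
theorem change_control_nonneg {j i : ℕ} (j' : Fin k) (i' : Fin (a + b))
    (hlt : J < j + 1 ∨ J = j + 1 ∧ p ≤ i) :
    0 ≤ ind (controlAdj a j i j' i') * (support a b m k j i J p (.inr (j', i')) -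
      support a b m k j i (j + 1) i (.inr (j', i'))) := by
  classical
  by_cases h : controlAdj a j i j' i'
  · rw [support_control _ _ h, support_control _ _ h, ind_pos h]
    unfold Flipped
    split_ifs <;> omega
  · simp [ind_neg h]

theorem change_control_nonpos {j i : ℕ} (j' : Fin k) (i' : Fin (a + b))
    (hlt : j + 1 < J ∨ J = j + 1 ∧ i ≤ p) :
    ind (controlAdj a j i j' i') * (support a b m k j i J p (.inr (j', i')) -
      support a b m k j i (j + 1) i (.inr (j', i'))) ≤ 0 := by
  classical
  by_cases h : controlAdj a j i j' i'
  · rw [support_control _ _ h, support_control _ _ h, ind_pos h]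
    unfold Flipped
    split_ifs <;> omega
  · simp [ind_neg h]

theorem change_base_bounds (j i : ℕ) (l : Fin m) :
    -(2 * ind (controlBaseAdj a b m i l)) ≤
      ind (controlBaseAdj a b m i l) * (support a b m k j i J p (.inl l) -
        support a b m k j i (j + 1) i (.inl l)) ∧
    ind (controlBaseAdj a b m i l) * (support a b m k j i J p (.inl l) -
        support a b m k j i (j + 1) i (.inl l)) ≤ 2 * ind (controlBaseAdj a b m i l) := by
  have h1 := support_bounds a b m k j i J p (.inl l)
  have h2 := support_bounds a b m k j i (j + 1) i (.inl l)
  by_cases h : controlBaseAdj a b m i l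
  · rw [ind_pos h]
    constructor <;> linarith
  · simp [ind_neg h]

theorem sum_ind {α : Type*} [Fintype α] (P : α → Prop) [DecidablePred P] :
    ∑ x, ind (P x) = ((Finset.univ.filter P).card : ℤ) := by
  rw [Finset.card_filter]
  push_cast
  refine Finset.sum_congr rfl fun x _ => ?_
  unfold ind
  congr

theorem sum_ind_base_le (h : Admissible a b m k w) {i : ℕ} (hi : a ≤ i) :
    ∑ l : Fin m, ind (controlBaseAdj a b m i l) ≤ w + 1 := by
  classical
  have ha := h.le_a
  have hb := h.four_le_b
  have h1 : ∀ l : Fin m, ind (controlBaseAdj a b m i l) ≤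
      ind (i = a + (l + 1) % b) + ind ((l : ℕ) = 0) * 1 := by
    intro l
    have h2 : controlBaseAdj a b m i l → (i = a + (l + 1) % b ∨ (l : ℕ) = 0) := by
      unfold controlBaseAdj
      omega
    refine le_trans ?_ ((ind_or_le _ _).trans_eq (by rw [mul_one]))
    by_cases h3 : controlBaseAdj a b m i l
    · rw [ind_pos h3, ind_pos (h2 h3)]
    · rw [ind_neg h3]
      exact ind_nonneg _
  refine (Finset.sum_le_sum fun l _ => h1 l).trans ?_
  rw [Finset.sum_add_distrib, sum_fin_ind_eq _ (fun _ => 1)]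
  have h4 : ∑ l : Fin m, ind (i = a + ((l : ℕ) + 1) % b) ≤ w := by
    rw [sum_ind]
    have h5 : (Finset.univ.filter fun l : Fin m => i = a + ((l : ℕ) + 1) % b).card ≤
        (Finset.range w).card := by
      -- On a residue class modulo `b` the quotient by `b` is injective, and `m = b * w` leaves `w`
      -- quotients.
      refine Finset.card_le_card_of_injOn (fun l => (l : ℕ) / b) ?_ ?_
      · intro l _
        have := l.2
        simp only [Finset.coe_range, Set.mem_Iio]
        exact Nat.div_lt_of_lt_mul (h.m_eq ▸ this)
      · intro l hl l' hl' hdiv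
        simp only [Finset.coe_filter, Finset.mem_univ, true_and, Set.mem_ofPred_eq] at hl hl'
        have h6 : (l : ℕ) + 1 ≡ l' + 1 [MOD b] := by
          unfold Nat.ModEq
          omega
        have h7 : (l : ℕ) % b = l' % b := Nat.ModEq.add_right_cancel' 1 h6
        ext
        rw [← Nat.div_add_mod (l : ℕ) b, ← Nat.div_add_mod (l' : ℕ) b, h7]
        simp only at hdiv
        rw [hdiv]
    rw [Finset.card_range] at h5
    exact_mod_cast h5
  split_ifs <;> linarith

theorem le_sum_ind_charging (h : Admissible a b m k w) (i : ℕ) :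
    (w + 2 : ℤ) ≤ ∑ i' : Fin (a + b), ind ((i + i') % 2 = 1 ∧ (i' : ℕ) < a) := by
  classical
  have ha := h.le_a
  rw [sum_ind]
  have h5 : (Finset.univ : Finset (Fin (w + 2))).card ≤
      (Finset.univ.filter fun i' : Fin (a + b) => (i + i') % 2 = 1 ∧ (i' : ℕ) < a).card := by
    refine Finset.card_le_card_of_injOn (fun u => ⟨2 * u + (1 - i % 2), by omega⟩) ?_ ?_
    · intro u _
      have := u.2
      simp only [Finset.coe_filter, Finset.mem_univ, true_and, Set.mem_ofPred_eq]
      omega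
    · intro u _ u' _ huu
      simp only [Fin.mk.injEq] at huu
      ext
      omega
  rw [Finset.card_univ, Fintype.card_fin] at h5
  exact_mod_cast h5

/-- The total support of a control node. -/
noncomputable def totalSupport (a b m k : ℕ) (j : Fin k) (i : Fin (a + b)) (J p : ℕ) : ℤ :=
  ∑ x, ind ((relayGraph a b m k).Adj (.inr (j, i)) x) * support a b m k j i J p x

theorem totalSupport_sub (j : Fin k) (i : Fin (a + b)) (J p : ℕ) :
    totalSupport a b m k j i J p - totalSupport a b m k j i (j + 1) i =
      ∑ l : Fin m, ind (controlBaseAdj a b m i l) * (support a b m k j i J p (.inl l) -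
        support a b m k j i (j + 1) i (.inl l)) +
      ∑ y : Fin k × Fin (a + b), ind (controlAdj a j i y.1 y.2) *
        (support a b m k j i J p (.inr (y.1, y.2)) -
          support a b m k j i (j + 1) i (.inr (y.1, y.2))) := by
  rw [totalSupport, totalSupport, ← Finset.sum_sub_distrib, Fintype.sum_sum_type]
  simp only [← mul_sub]
  rfl

theorem two_le_sum_control {j : Fin k} {i : Fin (a + b)} (j' : Fin k) (i' : Fin (a + b))
    (hlt : J < j + 1 ∨ J = j + 1 ∧ p ≤ i) (hadj : controlAdj a j i j' i')
    (h1 : ¬Flipped J p j' i') (h2 : Flipped (j + 1) i j' i') :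
    2 ≤ ∑ y : Fin k × Fin (a + b), ind (controlAdj a j i y.1 y.2) *
        (support a b m k j i J p (.inr (y.1, y.2)) -
          support a b m k j i (j + 1) i (.inr (y.1, y.2))) := by
  classical
  refine le_trans ?_ (Finset.single_le_sum (fun y _ => change_control_nonneg y.1 y.2 hlt)
    (Finset.mem_univ (j', i')))
  simp only
  rw [support_control _ _ hadj, support_control _ _ hadj, ind_pos hadj, if_neg h1, if_pos h2]
  norm_num

theorem sum_control_le_neg_two {j : Fin k} {i : Fin (a + b)} (j' : Fin k) (i' : Fin (a + b))
    (hlt : j + 1 < J ∨ J = j + 1 ∧ i ≤ p) (hadj : controlAdj a j i j' i')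
    (h1 : Flipped J p j' i') (h2 : ¬Flipped (j + 1) i j' i') :
    ∑ y : Fin k × Fin (a + b), ind (controlAdj a j i y.1 y.2) *
        (support a b m k j i J p (.inr (y.1, y.2)) -
          support a b m k j i (j + 1) i (.inr (y.1, y.2))) ≤ -2 := by
  classical
  rw [← neg_le_neg_iff, ← Finset.sum_neg_distrib]
  refine le_trans ?_ (Finset.single_le_sum (fun y _ => neg_nonneg.2
    (change_control_nonpos y.1 y.2 hlt)) (Finset.mem_univ (j', i')))
  simp only
  rw [support_control _ _ hadj, support_control _ _ hadj, ind_pos hadj, if_pos h1, if_neg h2]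
  norm_num

/-- Before its turn the node has a control neighbor, or for position 0 possibly the last base node,
whose coming switch lowers its support by 2. The only loss to offset is the oscillation of base
neighbors of an upper node in earlier rounds. -/
theorem lt_totalSupport (h : Admissible a b m k w) (hp : IsPhase a b m k J p) (j : Fin k)
    (i : Fin (a + b)) (hlt : J < j + 1 ∨ J = j + 1 ∧ p < i) :
    totalSupport a b m k j i (j + 1) i + 1 ≤ totalSupport a b m k j i J p := by
  classical
  have ha := h.le_a
  have ha2 := h.odd_a
  have hb := h.four_le_b
  have hb2 := h.even_b
  have hm := h.m_bounds
  have hj := j.2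
  have hi := i.2
  have hplt := hp.lt
  have hlt' : J < j + 1 ∨ J = j + 1 ∧ p ≤ i := by omega
  rw [← sub_nonneg, add_comm, ← sub_sub, sub_right_comm, totalSupport_sub]
  rw [sub_nonneg]
  have hX : 0 ≤ ∑ y : Fin k × Fin (a + b), ind (controlAdj a j i y.1 y.2) *
      (support a b m k j i J p (.inr (y.1, y.2)) -
        support a b m k j i (j + 1) i (.inr (y.1, y.2))) :=
    Finset.sum_nonneg fun y _ => change_control_nonneg y.1 y.2 hlt'
  by_cases hi0 : (i : ℕ) = 0
  · have hB : ∀ l : Fin m, 0 ≤ ind (controlBaseAdj a b m i l) *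
        (support a b m k j i J p (.inl l) - support a b m k j i (j + 1) i (.inl l)) := by
      intro l
      by_cases hl : controlBaseAdj a b m i l
      · have h2 : support a b m k j i (j + 1) i (.inl l) = -1 := by
          unfold controlBaseAdj at hl
          rw [support_base, if_pos]
          split_ifs <;> omega
        have h3 := (support_bounds a b m k j i J p (.inl l)).1
        rw [h2]
        exact mul_nonneg (ind_nonneg _) (by linarith)
      · simp [ind_neg hl]
    -- In the preceding round the last base node, which closes the wave, has not switched yet. In
    -- still earlier rounds it may have any color, and the first charging node of round `j - 1` is
    -- used instead.
    by_cases hJ : J = j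
    · have hlast : controlBaseAdj a b m i (⟨m - 1, by omega⟩ : Fin m) := by
        unfold controlBaseAdj
        simp only
        omega
      have h4 := Finset.single_le_sum (fun l _ => hB l)
        (Finset.mem_univ (⟨m - 1, by omega⟩ : Fin m))
      rw [ind_pos hlast, support_base, support_base, if_neg, if_pos] at h4
      · linarith
      · simp only
        split_ifs <;> omega
      · simp only
        split_ifs <;> omega
    · have h4 := two_le_sum_control (m := m) (⟨j - 1, by omega⟩ : Fin k) i hlt'
        (by unfold controlAdj; dsimp only; omega) (by unfold Flipped; dsimp only; omega)
        (by unfold Flipped; dsimp only; omega)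
      have h5 := Finset.sum_nonneg fun l (_ : l ∈ Finset.univ) => hB l
      linarith
  · by_cases hJ : J = j + 1
    · have h4 := two_le_sum_control (m := m) j (⟨i - 1, by omega⟩ : Fin (a + b)) hlt'
        (by unfold controlAdj; dsimp only; omega) (by unfold Flipped; dsimp only; omega)
        (by unfold Flipped; dsimp only; omega)
      have h5 : ∀ l : Fin m, ind (controlBaseAdj a b m i l) *
          (support a b m k j i J p (.inl l) - support a b m k j i (j + 1) i (.inl l)) = 0 := by
        intro l
        by_cases hl : controlBaseAdj a b m i l
        · have hia : a ≤ i := by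
            unfold controlBaseAdj at hl
            omega
          rw [hJ, support_base_of_upper h hia hl (by omega) hi,
            support_base_of_upper h hia hl le_rfl hi]
          simp
        · simp [ind_neg hl]
      rw [Finset.sum_eq_zero fun l _ => h5 l]
      linarith
    · by_cases hia : (i : ℕ) < a
      · have h4 := two_le_sum_control (m := m) j (⟨i - 1, by omega⟩ : Fin (a + b)) hlt'
          (by unfold controlAdj; dsimp only; omega) (by unfold Flipped; dsimp only; omega)
          (by unfold Flipped; dsimp only; omega)
        have h5 : ∀ l : Fin m, ¬ controlBaseAdj a b m i l := by
          intro l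
          unfold controlBaseAdj
          omega
        rw [Finset.sum_eq_zero fun l _ => by rw [ind_neg (h5 l), zero_mul]]
        linarith
      -- The at most `w + 1` base neighbors cost at most `2 * (w + 1)`, while at least `w + 2`
      -- charging nodes of the same round, still unswitched, give `2 * (w + 2)`.
      · have h4 : -(2 * (w + 1 : ℤ)) ≤ ∑ l : Fin m, ind (controlBaseAdj a b m i l) *
            (support a b m k j i J p (.inl l) - support a b m k j i (j + 1) i (.inl l)) := by
          refine le_trans ?_ (Finset.sum_le_sum fun l _ => (change_base_bounds _ _ l).1)
          rw [Finset.sum_neg_distrib, ← Finset.mul_sum]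
          have := sum_ind_base_le h (not_lt.1 hia)
          linarith
        have h5 : 2 * (w + 2 : ℤ) ≤ ∑ y : Fin k × Fin (a + b), ind (controlAdj a j i y.1 y.2) *
            (support a b m k j i J p (.inr (y.1, y.2)) -
              support a b m k j i (j + 1) i (.inr (y.1, y.2))) := by
          rw [Fintype.sum_prod_type]
          refine le_trans ?_ (Finset.single_le_sum (fun j' _ => Finset.sum_nonneg fun i' _ =>
            change_control_nonneg j' i' hlt') (Finset.mem_univ j))
          refine (mul_le_mul_of_nonneg_left (le_sum_ind_charging h i) zero_le_two).trans ?_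
          rw [Finset.mul_sum]
          refine Finset.sum_le_sum fun i' _ => ?_
          by_cases hi' : (i + i' : ℕ) % 2 = 1 ∧ (i' : ℕ) < a
          · have hadj : controlAdj a j i j i' := by
              unfold controlAdj
              omega
            rw [support_control _ _ hadj, support_control _ _ hadj, ind_pos hadj, ind_pos hi',
              if_neg (by unfold Flipped; omega), if_pos (by unfold Flipped; omega)]
            norm_num
          · rw [ind_neg hi', mul_zero]
            exact change_control_nonneg j i' hlt'
        linarith

/-- Control neighbors can only lower the support, and base neighbors of an upper node were already
at their maximum at its turn. Only position 0 can gain, by 2 from the last base node in later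
rounds, which the switch of charging node 1 offsets. -/
theorem totalSupport_le (h : Admissible a b m k w) (hp : IsPhase a b m k J p) (j : Fin k)
    (i : Fin (a + b)) (hlt : j + 1 < J ∨ J = j + 1 ∧ i < p) :
    totalSupport a b m k j i J p ≤ totalSupport a b m k j i (j + 1) i + 1 := by
  classical
  have ha := h.le_a
  have ha2 := h.odd_a
  have hb := h.four_le_b
  have hb2 := h.even_b
  have hm := h.m_bounds
  have hj := j.2
  have hi := i.2
  have hplt := hp.lt
  have hlt' : j + 1 < J ∨ J = j + 1 ∧ i ≤ p := by omega
  rw [← sub_le_iff_le_add', totalSupport_sub]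
  have hX : ∑ y : Fin k × Fin (a + b), ind (controlAdj a j i y.1 y.2) *
      (support a b m k j i J p (.inr (y.1, y.2)) -
        support a b m k j i (j + 1) i (.inr (y.1, y.2))) ≤ 0 :=
    Finset.sum_nonpos fun y _ => change_control_nonpos y.1 y.2 hlt'
  by_cases hi0 : (i : ℕ) = 0
  · have hadj : ∀ l : Fin m, controlBaseAdj a b m i l ↔ (l : ℕ) = m - 1 := by
      intro l
      unfold controlBaseAdj
      omega
    by_cases hJ : J = j + 1
    · have h5 : ∀ l : Fin m, ind (controlBaseAdj a b m i l) *
          (support a b m k j i J p (.inl l) - support a b m k j i (j + 1) i (.inl l)) = 0 := by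
        intro l
        by_cases hl : controlBaseAdj a b m i l
        · have hl' := (hadj l).1 hl
          rw [support_base, support_base, if_pos, if_pos]
          · simp
          · split_ifs <;> omega
          · split_ifs <;> omega
        · simp [ind_neg hl]
      rw [Finset.sum_eq_zero fun l _ => h5 l]
      linarith
    · have h4 := sum_control_le_neg_two (m := m) j (⟨1, by omega⟩ : Fin (a + b)) hlt'
        (by unfold controlAdj; dsimp only; omega) (by unfold Flipped; dsimp only; omega)
        (by unfold Flipped; dsimp only; omega)
      have h5 : ∑ l : Fin m, ind (controlBaseAdj a b m i l) *
          (support a b m k j i J p (.inl l) - support a b m k j i (j + 1) i (.inl l)) ≤ 2 := by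
        refine (Finset.sum_le_sum fun l _ => (change_base_bounds _ _ l).2).trans ?_
        simp only [hadj]
        rw [← Finset.mul_sum]
        have h6 := sum_fin_ind_eq (n := m) (m - 1) fun _ => 1
        simp only [mul_one] at h6
        rw [h6]
        split_ifs <;> norm_num
      linarith
  · have h5 : ∀ l : Fin m, ind (controlBaseAdj a b m i l) *
        (support a b m k j i J p (.inl l) - support a b m k j i (j + 1) i (.inl l)) ≤ 0 := by
      intro l
      by_cases hl : controlBaseAdj a b m i l
      · have hia : a ≤ i := by
          unfold controlBaseAdj at hl
          omega
        rw [support_base_of_upper h hia hl le_rfl hi]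
        exact mul_nonpos_of_nonneg_of_nonpos (ind_nonneg _)
          (sub_nonpos.2 (support_bounds _ _ _ _ _ _ _ _ _).2)
      · simp [ind_neg hl]
    have h6 := Finset.sum_nonpos fun l (_ : l ∈ Finset.univ) => h5 l
    linarith

/-- The biases of the relay network: a control node has balance `-1` when it is about to switch. -/
noncomputable def relayBias (a b m k : ℕ) : RelayNode a b m k → ℤ
  | .inl _ => 0
  | .inr (j, i) =>
    ∑ x, ind ((relayGraph a b m k).Adj (.inr (j, i)) x) *
      spin (phaseColoring a b m k (j + 1) i x) - spin (parityColor (i + j + 1))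

theorem totalSupport_eq (j : Fin k) (i : Fin (a + b)) (J p : ℕ) :
    totalSupport a b m k j i J p = -(spin (parityColor (i + j + 1)) *
      ∑ x, ind ((relayGraph a b m k).Adj (.inr (j, i)) x) *
        spin (phaseColoring a b m k J p x)) := by
  rw [totalSupport, Finset.mul_sum, ← Finset.sum_neg_distrib]
  refine Finset.sum_congr rfl fun x _ => ?_
  rw [support]
  ring

-- The bias normalizes the value at the node's turn to -1, and the node's own switch reverses the
-- sign. Hence nonnegative balance means a support increase of at least 1 before the turn and of at
-- most 1 after it.
open Classical in
theorem biasedBalance_control (j : Fin k) (i : Fin (a + b)) (J p : ℕ) :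
    biasedBalance (relayGraph a b m k) (relayBias a b m k) (phaseColoring a b m k J p)
      (.inr (j, i)) = (if Flipped J p j i then -1 else 1) *
        (totalSupport a b m k j i J p - totalSupport a b m k j i (j + 1) i - 1) := by
  have hs := spin_mul_self (parityColor (i + j + 1))
  have hc : spin (phaseColoring a b m k J p (.inr (j, i))) =
      (if Flipped J p j i then -1 else 1) * spin (parityColor (i + j + 1)) := by
    simp only [phaseColoring, spin_parityColor]
    split_ifs <;> omega
  rw [totalSupport_eq, totalSupport_eq, biasedBalance, relayBias, hc]
  linear_combination (-(if Flipped J p j i then -1 else 1)) * hs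

theorem natAbs_relayBias_le (x : RelayNode a b m k) :
    (relayBias a b m k x).natAbs ≤ Fintype.card (RelayNode a b m k) := by
  rcases x with l | ⟨j, i⟩
  · simp [relayBias]
  · set x : RelayNode a b m k := .inr (j, i) with hx
    have h1 : |∑ y, ind ((relayGraph a b m k).Adj x y) *
        spin (phaseColoring a b m k (j + 1) i y)| ≤ Fintype.card (RelayNode a b m k) - 1 := by
      refine (Finset.abs_sum_le_sum_abs _ _).trans ?_
      classical
      -- The node is not its own neighbor; the unit saved pays for the extra spin in `relayBias`.
      rw [← Finset.add_sum_erase _ _ (Finset.mem_univ x), ind_neg (SimpleGraph.irrefl _), zero_mul,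
        abs_zero, zero_add]
      refine (Finset.sum_le_card_nsmul _ _ 1 fun y _ => ?_).trans ?_
      · rw [abs_mul, abs_of_nonneg (ind_nonneg _)]
        rcases spin_eq_one_or (phaseColoring a b m k (j + 1) i y) with h | h <;>
          simpa [h] using ind_le_one _
      · rw [Finset.card_erase_of_mem (Finset.mem_univ x), Finset.card_univ, nsmul_eq_mul, mul_one,
          Nat.cast_sub (Fintype.card_pos_iff.2 ⟨x⟩)]
        simp
    have h2 := spin_eq_one_or (parityColor (i + j + 1))
    rw [hx, relayBias, ← hx]
    rw [abs_le] at h1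
    omega

theorem biasedBalance_neg_iff (h : Admissible a b m k w) (hp : IsPhase a b m k J p)
    (x : RelayNode a b m k) :
    biasedBalance (relayGraph a b m k) (relayBias a b m k) (phaseColoring a b m k J p) x < 0 ↔
      IsNext J p x := by
  classical
  have hb := h.four_le_b
  have ha := h.le_a
  rcases x with l | ⟨j, i⟩
  · have hmod : ((l : ℕ) + 1) % b < b := Nat.mod_lt _ (by omega)
    rw [biasedBalance_base h hp _ l rfl]
    change _ ↔ a + b + l = p
    split_ifs <;> omega
  · rw [biasedBalance_control]
    change _ ↔ (j : ℕ) + 1 = J ∧ (i : ℕ) = p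
    by_cases h1 : J < j + 1 ∨ J = j + 1 ∧ p < i
    · have h2 := lt_totalSupport h hp j i h1
      rw [if_neg (by unfold Flipped; omega)]
      omega
    · by_cases h3 : j + 1 < J ∨ J = j + 1 ∧ i < p
      · have h4 := totalSupport_le h hp j i h3
        rw [if_pos (by unfold Flipped; omega)]
        omega
      · obtain ⟨rfl, rfl⟩ : J = j + 1 ∧ p = i := by omega
        rw [if_neg (by unfold Flipped; omega)]
        simp

/-! ### The forced trajectory and its relay chain -/

theorem isPhase_div_mod (h : Admissible a b m k w) {t T : ℕ}
    (hT : T + (a + b) = (k + 1) * (a + b + m)) (ht : t ≤ T) :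
    IsPhase a b m k ((t + (a + b)) / (a + b + m)) ((t + (a + b)) % (a + b + m)) := by
  have hm := h.m_bounds.2
  have hL : 0 < a + b + m := by omega
  have hdm := Nat.div_add_mod (t + (a + b)) (a + b + m)
  have hle : (t + (a + b)) / (a + b + m) ≤ k + 1 :=
    Nat.div_le_of_le_mul (by rw [mul_comm]; omega)
  refine ⟨Nat.mod_lt _ hL, fun h0 => ?_, hle, fun h0 => ?_⟩
  · rw [h0, mul_zero] at hdm
    omega
  · rw [h0, mul_comm] at hdm
    omega

theorem div_le_of_lt (h : Admissible a b m k w) {t T : ℕ}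
    (hT : T + (a + b) = (k + 1) * (a + b + m)) (ht : t < T) :
    (t + (a + b)) / (a + b + m) ≤ k := by
  have hm := h.m_bounds.2
  have h1 : (t + (a + b)) / (a + b + m) < k + 1 :=
    (Nat.div_lt_iff_lt_mul (by omega)).2 (by omega)
  exact Nat.le_of_lt_succ h1

theorem exists_forall_isNext_iff (hp : IsPhase a b m k J p) (hJ : J ≤ k) :
    ∃ v : RelayNode a b m k, ∀ x, IsNext J p x ↔ x = v := by
  obtain ⟨h1, h2, -, -⟩ := hp
  by_cases hpab : p < a + b
  · refine ⟨.inr (⟨J - 1, by omega⟩, ⟨p, hpab⟩), ?_⟩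
    rintro (l | ⟨j, i⟩)
    · simp only [IsNext, reduceCtorEq, iff_false]
      omega
    · simp only [IsNext, Sum.inr.injEq, Prod.mk.injEq, Fin.ext_iff]
      omega
  · refine ⟨.inl ⟨p - (a + b), by omega⟩, ?_⟩
    rintro (l | ⟨j, i⟩)
    · simp only [IsNext, Sum.inl.injEq, Fin.ext_iff]
      omega
    · simp only [IsNext, reduceCtorEq, iff_false]
      omega

theorem phaseColoring_succ_apply (hp : IsPhase a b m k J p) (x : RelayNode a b m k) :
    (p + 1 < a + b + m →
      (IsNext J p x → phaseColoring a b m k J (p + 1) x = !phaseColoring a b m k J p x) ∧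
      (¬IsNext J p x → phaseColoring a b m k J (p + 1) x = phaseColoring a b m k J p x)) ∧
    (p + 1 = a + b + m → 0 < m →
      (IsNext J p x → phaseColoring a b m k (J + 1) 0 x = !phaseColoring a b m k J p x) ∧
      (¬IsNext J p x → phaseColoring a b m k (J + 1) 0 x = phaseColoring a b m k J p x)) := by
  classical
  obtain ⟨h1, h2, -, -⟩ := hp
  rcases x with l | ⟨j, i⟩
  · have := l.2
    simp only [IsNext, phaseColoring, parityColor_eq_iff, parityColor_eq_not_iff, phase]
    refine ⟨fun h3 => ⟨fun h4 => ?_, fun h4 => ?_⟩, fun h3 h5 => ⟨fun h4 => ?_, fun h4 => ?_⟩⟩ <;>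
      split_ifs <;> omega
  · have := i.2
    simp only [IsNext, phaseColoring, parityColor_eq_iff, parityColor_eq_not_iff]
    refine ⟨fun h3 => ⟨fun h4 => ?_, fun h4 => ?_⟩, fun h3 h5 => ⟨fun h4 => ?_, fun h4 => ?_⟩⟩ <;>
      split_ifs <;> simp only [Flipped] at * <;> omega

theorem div_mod_succ {t L : ℕ} (hL : 0 < L) :
    (t % L + 1 < L ∧ (t + 1) / L = t / L ∧ (t + 1) % L = t % L + 1) ∨
      (t % L + 1 = L ∧ (t + 1) / L = t / L + 1 ∧ (t + 1) % L = 0) := by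
  have hdm := Nat.div_add_mod t L
  have hlt := Nat.mod_lt t hL
  by_cases h : t % L + 1 < L
  · left
    have h1 : t + 1 = (t % L + 1) + L * (t / L) := by omega
    refine ⟨h, ?_, ?_⟩
    · conv_lhs => rw [h1]
      rw [Nat.add_mul_div_left _ _ hL, Nat.div_eq_of_lt h, zero_add]
    · conv_lhs => rw [h1]
      rw [Nat.add_mul_mod_self_left, Nat.mod_eq_of_lt h]
  · right
    have h1 : t + 1 = L * (t / L + 1) := by rw [mul_add]; omega
    refine ⟨by omega, ?_, ?_⟩
    · conv_lhs => rw [h1]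
      rw [Nat.mul_div_cancel_left _ hL]
    · rw [h1, Nat.mul_mod_right]

/-- In a suitable graph on `n` nodes, the minority process is forced to send `k + 1` signals
through a chain of `m - 1` relays. -/
theorem exists_isForced_relayChain (h : Admissible a b m k w) {n : ℕ}
    (hn : 3 * (m + k * (a + b)) ≤ n) :
    ∃ (G : SimpleGraph (Fin n)) (c : ℕ → Coloring (Fin n)) (v : ℕ → Fin n) (T : ℕ),
      IsForced G c v T ∧ k * m ≤ T ∧ ∃ R : RelayChain G (c 0) (m - 1),
        ∀ i, ∃ s : Finset ℕ, s.card = k + 1 ∧ ∀ t ∈ s, t < T ∧ v t = R.base i := by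
  classical
  have ha := h.le_a
  have hb := h.four_le_b
  have hb2 := h.even_b
  have hm := h.m_bounds.2
  have hk := h.odd_k
  have hL : 0 < a + b + m := by omega
  set L := a + b + m with hLdef
  -- Time is shifted by `a + b`, because round 0 starts at base node 0. The end is phase `(k + 1,
  -- 0)`, where no control nodes remain to switch.
  obtain ⟨T, hT⟩ : ∃ T, T + (a + b) = (k + 1) * L :=
    ⟨(k + 1) * L - (a + b), Nat.sub_add_cancel (by rw [add_mul]; omega)⟩
  set c : ℕ → Coloring (RelayNode a b m k) := fun t =>
    phaseColoring a b m k ((t + (a + b)) / L) ((t + (a + b)) % L) with hc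
  have hphase : ∀ t ≤ T, IsPhase a b m k ((t + (a + b)) / L) ((t + (a + b)) % L) :=
    fun t ht => isPhase_div_mod h hT ht
  have hnext : ∀ t, ∃ v : RelayNode a b m k, t < T →
      ∀ x, IsNext ((t + (a + b)) / L) ((t + (a + b)) % L) x ↔ x = v := by
    intro t
    by_cases ht : t < T
    · obtain ⟨v, hv⟩ := exists_forall_isNext_iff (hphase t ht.le) (div_le_of_lt h hT ht)
      exact ⟨v, fun _ => hv⟩
    · exact ⟨.inl ⟨0, by omega⟩, fun h => absurd h ht⟩
  choose v hv using hnext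
  obtain ⟨G, c', f, hforced, hadj, hcol, hbal⟩ :=
    exists_isForced_of_biasedBalance (relayGraph a b m k) (relayBias a b m k) c v T n
      natAbs_relayBias_le (by simpa using hn)
      (fun t ht x => (biasedBalance_neg_iff h (hphase t ht.le) x).trans (hv t ht x))
      (by
        intro t ht
        funext x
        have h1 := phaseColoring_succ_apply (hphase t ht.le) x
        have h2 := hv t ht x
        simp only [hc, switch, Set.mem_singleton_iff, ← h2]
        rw [show t + 1 + (a + b) = t + (a + b) + 1 by omega]
        rcases div_mod_succ (t := t + (a + b)) hL with ⟨h3, h4, h5⟩ | ⟨h3, h4, h5⟩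
        · rw [h4, h5]
          split_ifs with h6
          · exact (h1.1 h3).1 h6
          · exact (h1.1 h3).2 h6
        · rw [h4, h5]
          split_ifs with h6
          · exact (h1.2 h3 (by omega)).1 h6
          · exact (h1.2 h3 (by omega)).2 h6)
      (by
        intro x
        rw [← not_lt, biasedBalance_neg_iff h (hphase T le_rfl), hT, Nat.mul_div_cancel _ hL,
          Nat.mul_mod_left]
        rcases x with l | ⟨j, i⟩
        · simp only [IsNext]
          omega
        · have := j.2
          simp only [IsNext]
          omega)
  have hc0 : c 0 = phaseColoring a b m k 0 (a + b) := by
    simp only [hc]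
    rw [zero_add, Nat.div_eq_of_lt (by omega), Nat.mod_eq_of_lt (by omega)]
  have hp0 : IsPhase a b m k 0 (a + b) := ⟨by omega, by omega, by omega, by omega⟩
  have hmod : ∀ x, x % b < b := fun x => Nat.mod_lt _ (by omega)
  have hmod2 : ∀ x, x % b % 2 = x % 2 := fun x =>
    Nat.mod_mod_of_dvd _ (Nat.dvd_of_mod_eq_zero hb2)
  -- Base node 0 is left out: it is switchable initially, with balance -1 instead of 1. The upper
  -- nodes are taken from the first group.
  let B : Fin (m - 1) → RelayNode a b m k := fun i => .inl ⟨i + 1, by omega⟩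
  let U : Fin (m - 1) → RelayNode a b m k := fun i =>
    .inr (⟨0, by omega⟩, ⟨a + ((i : ℕ) + 1 + 1) % b, by have := hmod ((i : ℕ) + 1 + 1); omega⟩)
  refine ⟨G, c', f ∘ v, T, hforced, ?_, ?_⟩
  · have h1 : (k + 1) * L = k * m + k * (a + b) + L := by
      rw [hLdef]
      ring
    omega
  · refine ⟨{
      base := fun i => f (B i)
      upper := fun i => f (U i)
      base_injective := fun i j hij => by
        have := f.injective hij
        simp only [B, Sum.inl.injEq, Fin.mk.injEq] at this
        omega
      upper_ne_base := fun i j hij => by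
        have := f.injective hij
        simp [B, U] at this
      adj_upper := fun i => hadj _ _ (Or.inl rfl)
      color_upper := fun i => by
        rw [hcol, hcol, hc0]
        have h1 := hmod2 ((i : ℕ) + 1 + 1)
        have h2 : ¬Flipped 0 (a + b) 0 (a + ((i : ℕ) + 1 + 1) % b) := by
          unfold Flipped
          omega
        simp only [B, U, phaseColoring, parityColor_eq_iff, phase, if_neg h2]
        split_ifs <;> omega
      adj_next := fun i j hij => hadj _ _ (Or.inl (by simp only; omega))
      color_next := fun i j hij => by
        rw [hcol, hcol, hc0]
        simp only [B, phaseColoring, parityColor_eq_not_iff, phase]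
        split_ifs <;> omega
      balance_base := fun i => by
        have h1 := hmod ((i : ℕ) + 1 + 1)
        rw [hbal, hc0, biasedBalance_base h hp0 _ _ rfl]
        dsimp only
        split_ifs <;> omega }, ?_⟩
    intro i
    have hi := i.2
    -- Base node `i + 1` switches once in each of the rounds `0, …, k`.
    refine ⟨(Finset.range (k + 1)).image fun J => J * L + (i + 1), ?_, ?_⟩
    · rw [Finset.card_image_of_injective, Finset.card_range]
      intro J J' hJ
      simp only [add_left_inj] at hJ
      exact Nat.eq_of_mul_eq_mul_right hL hJ
    · intro t ht
      obtain ⟨J, hJ, rfl⟩ := Finset.mem_image.1 ht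
      rw [Finset.mem_range, Nat.lt_succ_iff] at hJ
      have h1 : J * L ≤ k * L := Nat.mul_le_mul_right L hJ
      have h2 : (k + 1) * L = k * L + L := by ring
      have h3 : J * L + (i + 1) < T := by omega
      refine ⟨h3, ?_⟩
      have h4 : J * L + (i + 1) + (a + b) = (a + b + (i + 1)) + J * L := by omega
      have h5 : a + b + ((i : ℕ) + 1) < L := by omega
      have h6 := (hv _ h3 (B i)).1 (by
        rw [h4, Nat.add_mul_div_right _ _ hL, Nat.add_mul_mod_self_right, Nat.div_eq_of_lt h5,
          Nat.mod_eq_of_lt h5, zero_add]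
        exact (rfl : a + b + ((i : ℕ) + 1) = _))
      simp only [Function.comp_apply, ← h6]

/-! ### Choice of sizes -/

theorem exists_relay_size {n : ℕ} (hn : 400 ≤ n) :
    ∃ q : ℕ, 2 ≤ q ∧ 100 * q ^ 2 ≤ n ∧ Real.sqrt n ≤ 15 * q := by
  refine ⟨Nat.sqrt n / 10, ?_, ?_, ?_⟩
  · have : 20 ≤ Nat.sqrt n := Nat.le_sqrt.2 (by omega)
    omega
  · have h1 : 10 * (Nat.sqrt n / 10) ≤ Nat.sqrt n := Nat.mul_div_le _ _
    have h2 := Nat.sqrt_le' n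
    have h3 := Nat.pow_le_pow_left h1 2
    rw [mul_pow] at h3
    omega
  · have h1 : 20 ≤ Nat.sqrt n := Nat.le_sqrt.2 (by omega)
    have h2 : Nat.sqrt n + 1 ≤ 15 * (Nat.sqrt n / 10) := by omega
    have h3 : (Nat.sqrt n + 1 : ℝ) ≤ 15 * (Nat.sqrt n / 10 : ℕ) := by exact_mod_cast h2
    refine le_trans (Real.sqrt_le_iff.2 ⟨by positivity, ?_⟩) h3
    exact_mod_cast (Nat.lt_succ_sqrt' n).le

end MinorityProcess

theorem mainTheorem3 :
    ∃ a : ℝ, 0 < a ∧ ∃ N : ℕ, ∀ n : ℕ, N ≤ n →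
      ∃ (G : SimpleGraph (Fin n)) (c : Coloring (Fin n)),
        -- sequential, independent and free benevolent models, and the synchronous model
        (∀ rule ∈ ({sequential, independent, free, synchronous} : Set (Rule (Fin n))),
          ENNReal.ofReal (a * (n : ℝ) ^ (3 / 2 : ℝ)) ≤ (stabilizationTime rule G c : ℝ≥0∞) ∧
          stabilizationTime rule G c < ⊤) ∧
        -- sequential random model
        (∀ᵐ ω ∂(processLaw (sequentialRandomStep G) c),
          ENNReal.ofReal (a * (n : ℝ) ^ (3 / 2 : ℝ)) ≤ (pathStabilizationTime G ω : ℝ≥0∞)) ∧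
        (∫⁻ ω, (pathStabilizationTime G ω : ℝ≥0∞)
          ∂(processLaw (sequentialRandomStep G) c) < ⊤) ∧
        -- concurrent random model, for every switching probability
        (∀ p : unitInterval, 0 < p →
          (∀ᵐ ω ∂(processLaw (concurrentRandomStep p G) c),
            ENNReal.ofReal (a * (n : ℝ) ^ (3 / 2 : ℝ)) ≤ (pathStabilizationTime G ω : ℝ≥0∞)) ∧
          (∫⁻ ω, (pathStabilizationTime G ω : ℝ≥0∞)
            ∂(processLaw (concurrentRandomStep p G) c) < ⊤)) ∧
        -- the switchable nodes always form an independent set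
        (∀ d ∈ reachable G c, G.IsIndepSet (switchable G d)) ∧
        -- a switchable base node of the relay chain is the only switchable node
        (∃ (m : ℕ) (R : RelayChain G c m), a * (n : ℝ) ≤ (m : ℝ) ∧
          (∀ d ∈ reachable G c, ∀ i : Fin m,
            R.base i ∈ switchable G d → switchable G d = {R.base i}) ∧
          (∀ l ∈ stabilizingRuns free G c, ∀ i : Fin m,
            a * Real.sqrt (n : ℝ) ≤ (switchCount (R.base i) l : ℝ))) := by
  refine ⟨1 / 500, by norm_num, 400, fun n hn => ?_⟩
  obtain ⟨q, hq2, hqn, hsq⟩ := exists_relay_size hn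
  -- The network has `16 * q ^ 2 + 16 * q + 5` nodes; three times this is at most `100 * q ^ 2` for
  -- `q ≥ 2`.
  have hadm : Admissible (4 * q + 5) (2 * q) (2 * q * (2 * q)) (2 * q + 1) (2 * q) :=
    ⟨by omega, by omega, by omega, by omega, by omega, by omega, rfl⟩
  obtain ⟨G, c, v, T, hforced, hkm, R, hR⟩ := exists_isForced_relayChain hadm (n := n)
    (by nlinarith)
  have hs0 := Real.sqrt_nonneg (n : ℝ)
  have hss : Real.sqrt (n : ℝ) ^ 2 = n := Real.sq_sqrt (Nat.cast_nonneg n)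
  have hq : (2 : ℝ) ≤ q := by exact_mod_cast hq2
  have hpow : (n : ℝ) ^ (3 / 2 : ℝ) = Real.sqrt n ^ 3 := by
    rw [Real.sqrt_eq_rpow, ← Real.rpow_natCast, ← Real.rpow_mul (Nat.cast_nonneg n)]
    norm_num
  have hT : ENNReal.ofReal (1 / 500 * (n : ℝ) ^ (3 / 2 : ℝ)) ≤ (T : ℝ≥0∞) := by
    rw [ENNReal.ofReal_le_natCast, hpow]
    have h1 : Real.sqrt n ^ 3 ≤ (15 * q) ^ 3 := pow_le_pow_left₀ hs0 hsq 3
    have h2 : ((2 * q + 1) * (2 * q * (2 * q)) : ℝ) ≤ T := by exact_mod_cast hkm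
    -- At least `8 * q ^ 3` steps are made, and `15 ^ 3 / 500 < 8`.
    nlinarith [sq_nonneg (q : ℝ)]
  refine ⟨G, c 0, ?_, ?_, hforced.processLaw_sequentialRandomStep.2, ?_,
    fun d hd => hforced.isIndepSet_switchable hd, _, R, ?_,
    fun d hd i hi => hforced.switchable_eq_of_mem hd hi, ?_⟩
  · intro rule hrule
    rw [hforced.stabilizationTime_eq hrule]
    exact ⟨by simpa using hT, ENat.natCast_lt_top T⟩
  · filter_upwards [hforced.processLaw_sequentialRandomStep.1] with ω hω using hT.trans hω
  · intro p hp
    obtain ⟨h1, h2⟩ := hforced.processLaw_concurrentRandomStep p hp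
    refine ⟨?_, h2⟩
    filter_upwards [h1] with ω hω using hT.trans hω
  · rw [Nat.cast_sub (by nlinarith)]
    push_cast
    nlinarith
  · intro l hl i
    obtain ⟨s, hs, hst⟩ := hR i
    have h1 := hforced.card_le_switchCount hl (R.base i) s hst
    rw [hs] at h1
    have h2 : ((2 * q + 1 + 1 : ℕ) : ℝ) ≤ switchCount (R.base i) l := by exact_mod_cast h1
    push_cast at h2
    linarith
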